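/- Consider the following scheduling problem with joint replenishment of a single resource, $1|jrp,s=1,r_j|F_{\max}+c_{\mathcal Q}$. An instance consists of $n$ jobs, where job $j$ has an integer processing time $p_j>0$ and an integer release date $r_j\ge 0$, and of integers $K_0,K_1\ge 0$, all given in binary. A solution $(S,\mathcal Q)$ consists of a starting time $S_j\in\mathbb R$ for every job $j$, and of a finite set $\mathcal Q$ of replenishment times in $\mathbb R$, at each of which the resource is replenished. It is feasible if $S_j+p_j\le S_k$ or $S_k+p_k\le S_j$ for all $j\ne k$, and if for every job $j$ the resource is replenished at some time in $[r_j,S_j]$. Its cost is $F_{\max}+c_{\mathcal Q}$, where $F_{\max}=\max_j (S_j+p_j-r_j)$ and $c_{\mathcal Q}=(K_0+K_1)\,|\mathcal Q|$. Theorem 5. There is an algorithm that computes, for every instance, a feasible solution of minimum cost over all feasible solutions, in time polynomial in the binary length of the instance (on a random access machine with logarithmic cost). -/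

import Mathlib

/-! ### Random access machines with logarithmic cost -/

namespace RAM

/-- Instructions of a random access machine over natural numbers.  `i j k` are register indices,
`l` is a position in the program.  There is no multiplication; `sub` is truncated subtraction. -/
inductive Instr where
  | const (i v : ℕ)
  | add (i j k : ℕ)
  | sub (i j k : ℕ)
  | load (i j : ℕ)
  | store (i j : ℕ)
  | read (i : ℕ)
  | write (i : ℕ)
  | jump (l : ℕ)
  | jumpIfZero (i l : ℕ)

/-- A program is a finite list of instructions; it does not depend on the input. -/
abbrev Program := List Instr

/-- A configuration: program counter, registers, addressable memory, the unread part of the input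
tape, and what has been written to the output tape so far. -/
structure Config where
  pc : ℕ
  reg : ℕ → ℕ
  mem : ℕ → ℕ
  input : List ℕ
  output : List ℕ

/-- Assign the value `v` to register `i` and go to the next instruction. -/
def Config.assign (c : Config) (i v : ℕ) : Config :=
  { c with pc := c.pc + 1, reg := Function.update c.reg i v }

/-- The effect of one instruction.  Reading past the end of the input yields `0`. -/
def Instr.exec (c : Config) : Instr → Config
  | const i v => c.assign i v
  | add i j k => c.assign i (c.reg j + c.reg k)
  | sub i j k => c.assign i (c.reg j - c.reg k)
  | load i j => c.assign i (c.mem (c.reg j))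
  | store i j => { c with pc := c.pc + 1, mem := Function.update c.mem (c.reg i) (c.reg j) }
  | read i => { c.assign i (c.input.headD 0) with input := c.input.tail }
  | write i => { c with pc := c.pc + 1, output := c.output ++ [c.reg i] }
  | jump l => { c with pc := l }
  | jumpIfZero i l => { c with pc := if c.reg i = 0 then l else c.pc + 1 }

/-- Logarithmic cost of one instruction: one plus the bit lengths of the numbers and addresses
that it handles. -/
def Instr.cost (c : Config) : Instr → ℕ
  | const _ v => 1 + v.size
  | add _ j k => 1 + (c.reg j).size + (c.reg k).size
  | sub _ j k => 1 + (c.reg j).size + (c.reg k).size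
  | load _ j => 1 + (c.reg j).size + (c.mem (c.reg j)).size
  | store i j => 1 + (c.reg i).size + (c.reg j).size
  | read _ => 1 + (c.input.headD 0).size
  | write i => 1 + (c.reg i).size
  | jump _ => 1
  | jumpIfZero i _ => 1 + (c.reg i).size

/-- `Runs P c t d`: started in configuration `c`, the program `P` halts (by moving the program
counter outside the program) in configuration `d`, at total cost `t`. -/
inductive Runs (P : Program) : Config → ℕ → Config → Prop
  | halt (c : Config) : P[c.pc]? = none → Runs P c 0 c
  | step (c : Config) (I : Instr) (t : ℕ) (d : Config) :
      P[c.pc]? = some I → Runs P (I.exec c) t d → Runs P c (I.cost c + t) d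

/-- The initial configuration: all registers and memory cells are `0`. -/
def Config.init (input : List ℕ) : Config where
  pc := 0
  reg := fun _ => 0
  mem := fun _ => 0
  input := input
  output := []

/-- On the given input, the program halts with the given output, at total cost `t`. -/
def Computes (P : Program) (input : List ℕ) (t : ℕ) (output : List ℕ) : Prop :=
  ∃ d : Config, Runs P (Config.init input) t d ∧ d.output = output

/-- The size of a list of numbers written in binary, with one separator after each number. -/
def inputSize (w : List ℕ) : ℕ := (w.map fun v => v.size + 1).sum

/-- A search problem, with instances `x : α` presented as `enc x` and with the set `good x` of
correct answers, is solvable in polynomial time: one program answers every instance correctly, at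
a logarithmic cost polynomially bounded in the binary size of the instance. -/
def SolvableInPolyTime {α : Type} (enc : α → List ℕ) (good : α → List ℕ → Prop) : Prop :=
  ∃ (P : Program) (q : Polynomial ℕ), ∀ x : α, ∃ (t : ℕ) (out : List ℕ),
    Computes P (enc x) t out ∧ t ≤ q.eval (inputSize (enc x)) ∧ good x out

end RAM

/-! ### Single machine scheduling with joint replenishment -/

namespace JRP

/-- An instance of the joint replenishment problem on a single machine, with `s` resources and
release dates. -/
structure Instance (s : ℕ) where
  /-- number of jobs -/
  n : ℕ
  /-- processing times -/
  p : Fin n → ℕ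
  /-- release dates -/
  r : Fin n → ℕ
  /-- the resources required by each job -/
  req : Fin n → Finset (Fin s)
  /-- cost paid at each time moment when any replenishment occurs -/
  K₀ : ℕ
  /-- cost of replenishing each resource -/
  K : Fin s → ℕ
  p_pos : ∀ j, 0 < p j
  req_nonempty : ∀ j, (req j).Nonempty

/-- A schedule (the starting time of each of `n` jobs) together with a replenishment structure
(a list of subsets of the `s` resources with time moments), where times are of type `T`. -/
structure Solution (n s : ℕ) (T : Type) where
  start : Fin n → T
  repl : List (Finset (Fin s) × T)

/-- A solution with integral times, seen as a solution with real times. -/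
def Solution.toReal {n s : ℕ} (σ : Solution n s ℕ) : Solution n s ℝ where
  start := fun j => (σ.start j : ℝ)
  repl := σ.repl.map fun e => (e.1, (e.2 : ℝ))

variable {s : ℕ}

/-- Job `j` is ready to be started at time `t`: each resource that it requires is replenished at
some time moment in `[r j, t]`. -/
def Instance.Ready (I : Instance s) (Q : List (Finset (Fin s) × ℝ)) (j : Fin I.n) (t : ℝ) : Prop :=
  ∀ i ∈ I.req j, ∃ e ∈ Q, i ∈ e.1 ∧ (I.r j : ℝ) ≤ e.2 ∧ e.2 ≤ t

/-- Feasible solutions. -/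
structure Instance.Feasible (I : Instance s) (σ : Solution I.n s ℝ) : Prop where
  /-- the time moments of the replenishment structure are strictly increasing -/
  increasing : σ.repl.Pairwise fun e e' => e.2 < e'.2
  /-- the jobs do not overlap in time -/
  disjoint : ∀ j k, j ≠ k →
    σ.start j + I.p j ≤ σ.start k ∨ σ.start k + I.p k ≤ σ.start j
  /-- each job is ready to be started at its starting time -/
  ready : ∀ j, I.Ready σ.repl j (σ.start j)

/-- The flow time (completion time minus release date) of job `j`. -/
noncomputable def Instance.flowTime (I : Instance s) (σ : Solution I.n s ℝ) (j : Fin I.n) : ℝ :=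
  σ.start j + I.p j - I.r j

/-- The maximum flow time (`0` if there are no jobs). -/
noncomputable def Instance.Fmax (I : Instance s) (σ : Solution I.n s ℝ) : ℝ :=
  ⨆ j, I.flowTime σ j

/-- The replenishment cost. -/
noncomputable def Instance.replCost (I : Instance s) (σ : Solution I.n s ℝ) : ℝ :=
  (σ.repl.map fun e => (I.K₀ : ℝ) + ∑ i ∈ e.1, (I.K i : ℝ)).sum

/-- The cost of a solution: maximum flow time plus replenishment cost. -/
noncomputable def Instance.cost (I : Instance s) (σ : Solution I.n s ℝ) : ℝ :=
  I.Fmax σ + I.replCost σ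

/-- Feasible solutions of minimum cost over the set of all feasible solutions. -/
def Instance.IsOptimal (I : Instance s) (σ : Solution I.n s ℝ) : Prop :=
  I.Feasible σ ∧ ∀ σ' : Solution I.n s ℝ, I.Feasible σ' → I.cost σ ≤ I.cost σ'

/-- The characteristic vector of a set of resources. -/
def bits (A : Finset (Fin s)) : List ℕ := List.ofFn fun i => if i ∈ A then 1 else 0

/-- The presentation of an instance: the number of jobs, the costs `K₀, K₁, …, Kₛ`, and, for each
job, its release date, its processing time and the set of the resources that it requires. -/
def Instance.encode (I : Instance s) : List ℕ :=
  [I.n, I.K₀] ++ List.ofFn I.K ++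
    (List.ofFn fun j => [I.r j, I.p j] ++ bits (I.req j)).flatten

/-- The presentation of a solution: the number of replenishments, the time moment and the set of
resources of each of them, and the starting times of the jobs. -/
def Solution.encode {n : ℕ} (σ : Solution n s ℕ) : List ℕ :=
  [σ.repl.length] ++ (σ.repl.map fun e => e.2 :: bits e.1).flatten ++ List.ofFn σ.start

/-- The correct answers to an instance: the presentations of its optimal solutions.  They have
integral times, and are optimal among all feasible solutions with real times. -/
def Instance.IsAnswer (I : Instance s) (out : List ℕ) : Prop :=
  ∃ σ : Solution I.n s ℕ, out = σ.encode ∧ I.IsOptimal σ.toReal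

end JRP

/-! ### Step counts and logarithmic cost -/

namespace RAM

/-! With one resource every job needs it, so only the replenishment times and their number matter.
Number the jobs by release date. A bound F on the flow times gives job l the deadline F + r l, so
release dates and deadlines are ordered alike. It therefore suffices to process the jobs in this
order, cut into consecutive batches, each replenished at the release date of its last job and run as
early as possible; this is `Good`. No schedule does better: when job l ends in such a batch
schedule, the machine has been busy with jobs b, ..., l since some time a before which no schedule
with the same replenishments can start any of them. In an arbitrary schedule one of these jobs ends
no earlier than a plus their total processing time, and it is released no later than l, so its flow
time is at least as large (`exists_le_completion`, `exists_good_of_schedule`).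

For fixed F and number m of batches, a backward dynamic program computes for each i a strict bound
on the completion time of the jobs before i under which the remaining jobs fit into m batches.
`Table.lt_of_good` shows that the bounds miss nothing, and `extract_spec` shows that they are
attained by schedules. Completion times have the form r a + p b + ... + p l, so only cubically many
values of F matter (`Good.exists_candidate`). Trying all of them with all m ≤ n minimizes F + m (K₀
+ K₁) (`search_spec`).

For the running time, the algorithm is written in a small language all of whose loops run exactly n
times, so a command takes a number of steps polynomial in n by its very form (`Cmd.compile_spec`).
The machine has no multiplication, so numbers gain at most one bit per step and the logarithmic cost
is polynomial too (`Steps.runs`). -/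

/-- `Steps P c k d`: the program `P` goes from `c` to `d` in `k` instructions. -/
inductive Steps (P : Program) : Config → ℕ → Config → Prop
  | refl (c : Config) : Steps P c 0 c
  | step {c : Config} {I : Instr} {k : ℕ} {d : Config} :
      P[c.pc]? = some I → Steps P (I.exec c) k d → Steps P c (k + 1) d

theorem Steps.trans {P : Program} {c d e : Config} {k l : ℕ} (h : Steps P c k d)
    (h' : Steps P d l e) : Steps P c (k + l) e := by
  induction h with
  | refl => simpa using h'
  | step hI _ ih =>
    have := Steps.step hI (ih h')
    rwa [add_right_comm]

theorem Steps.single {P : Program} {c : Config} {I : Instr} (h : P[c.pc]? = some I) :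
    Steps P c 1 (I.exec c) :=
  .step h (.refl _)

/-- All numbers in a configuration have at most `M` bits. -/
structure Config.Bounded (M : ℕ) (c : Config) : Prop where
  reg : ∀ i, (c.reg i).size ≤ M
  mem : ∀ i, (c.mem i).size ≤ M
  input : ∀ v ∈ c.input, v.size ≤ M

theorem size_add_le {a b M : ℕ} (ha : a.size ≤ M) (hb : b.size ≤ M) : (a + b).size ≤ M + 1 := by
  rw [Nat.size_le] at *
  rw [pow_succ]
  omega

theorem size_headD_le {l : List ℕ} {M : ℕ} (h : ∀ v ∈ l, v.size ≤ M) :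
    (l.headD 0).size ≤ M := by
  cases l with
  | nil => simp
  | cons a l => exact h a (by simp)

theorem Config.Bounded.mono {M N : ℕ} {c : Config} (h : c.Bounded M) (hMN : M ≤ N) :
    c.Bounded N :=
  ⟨fun i => (h.reg i).trans hMN, fun i => (h.mem i).trans hMN, fun v hv => (h.input v hv).trans hMN⟩

theorem Config.Bounded.assign {M : ℕ} {c : Config} (h : c.Bounded M) {i v : ℕ}
    (hv : v.size ≤ M) : (c.assign i v).Bounded M := by
  refine ⟨fun j => ?_, h.mem, h.input⟩
  by_cases hj : j = i
  · subst hj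
    simpa [Config.assign] using hv
  · simpa [Config.assign, hj] using h.reg j

theorem Config.Bounded.exec {M : ℕ} {c : Config} (h : c.Bounded M) {I : Instr}
    (hI : ∀ i v, I = .const i v → v.size ≤ M) : (I.exec c).Bounded (M + 1) := by
  have h' := h.mono (Nat.le_succ M)
  cases I with
  | const i v => exact h'.assign ((hI i v rfl).trans (Nat.le_succ M))
  | add i j k => exact h'.assign (size_add_le (h.reg j) (h.reg k))
  | sub i j k => exact h'.assign ((Nat.size_le_size (Nat.sub_le _ _)).trans (h'.reg j))
  | load i j => exact h'.assign (h'.mem _)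
  | store i j =>
    refine ⟨h'.reg, fun a => ?_, h'.input⟩
    by_cases ha : a = c.reg i
    · subst ha
      simpa [Instr.exec] using h'.reg j
    · simpa [Instr.exec, ha] using h'.mem a
  | read i =>
    have := h'.assign (i := i) (size_headD_le h'.input)
    exact ⟨this.reg, this.mem, fun v hv => h'.input v (List.mem_of_mem_tail hv)⟩
  | write i => exact ⟨h'.reg, h'.mem, h'.input⟩
  | jump l => exact ⟨h'.reg, h'.mem, h'.input⟩
  | jumpIfZero i l => exact ⟨h'.reg, h'.mem, h'.input⟩

theorem Config.Bounded.cost_le {M : ℕ} {c : Config} (h : c.Bounded M) {I : Instr}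
    (hI : ∀ i v, I = .const i v → v.size ≤ M) : I.cost c ≤ 1 + 2 * M := by
  cases I with
  | const i v => have := hI i v rfl; simp only [Instr.cost]; omega
  | add i j k => have := h.reg j; have := h.reg k; simp only [Instr.cost]; omega
  | sub i j k => have := h.reg j; have := h.reg k; simp only [Instr.cost]; omega
  | load i j => have := h.reg j; have := h.mem (c.reg j); simp only [Instr.cost]; omega
  | store i j => have := h.reg i; have := h.reg j; simp only [Instr.cost]; omega
  | read i => have := size_headD_le h.input; simp only [Instr.cost]; omega
  | write i => have := h.reg i; simp only [Instr.cost]; omega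
  | jump l => simp only [Instr.cost]; omega
  | jumpIfZero i l => have := h.reg i; simp only [Instr.cost]; omega

/-- Without multiplication, numbers grow by at most one bit per step, so that the logarithmic cost
is polynomially bounded in the number of steps. -/
theorem Steps.runs {P : Program} {c d : Config} {k : ℕ} (h : Steps P c k d)
    (hd : P[d.pc]? = none) : ∀ {M : ℕ}, c.Bounded M →
    (∀ i v, Instr.const i v ∈ P → v.size ≤ M) → ∃ t ≤ k * (1 + 2 * (M + k)), Runs P c t d := by
  induction h with
  | refl c => exact fun _ _ => ⟨0, by simp, .halt c hd⟩
  | @step c I k d hI _ ih =>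
    intro M hM hP
    have hI' : ∀ i v, I = .const i v → v.size ≤ M := by
      rintro i v rfl
      exact hP i v (List.mem_of_getElem? hI)
    obtain ⟨t, ht, hr⟩ := ih hd (hM.exec hI') fun i v hv => (hP i v hv).trans (Nat.le_succ M)
    refine ⟨I.cost c + t, ?_, .step c I t d hI hr⟩
    have := hM.cost_le hI'
    -- The bit bound after one step plus the number of remaining steps, `(M + 1) + k`, equals `M +
    -- (k + 1)`, so every step can be charged the same amount.
    nlinarith

theorem Config.bounded_init (w : List ℕ) : (Config.init w).Bounded (inputSize w) := by
  refine ⟨fun i => by simp [Config.init], fun i => by simp [Config.init], fun v hv => ?_⟩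
  have := List.single_le_sum (l := w.map fun v => v.size + 1) (by simp) (v.size + 1)
    (List.mem_map.2 ⟨v, hv, rfl⟩)
  simp only [inputSize]
  omega

/-! ### A structured language with bounded loops, and its compilation -/

/-- Expressions over variables named by `α` and arrays named by `β`; `size` is the common bound of
all loops. -/
inductive Expr (α β : Type) where
  | size
  | const (v : ℕ)
  | var (x : α)
  | add (a b : Expr α β)
  | sub (a b : Expr α β)
  | get (t : β) (a : Expr α β)

/-- Commands; `loop x c` runs `c` with `x = 0, …, n - 1`, where `n` is the size. -/
inductive Cmd (α β : Type) where
  | skip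
  | set (x : α) (a : Expr α β)
  | put (t : β) (a b : Expr α β)
  | read (x : α)
  | write (a : Expr α β)
  | seq (c d : Cmd α β)
  | ite (a : Expr α β) (c d : Cmd α β)
  | loop (x : α) (c : Cmd α β)

/-- The values of the variables and the arrays, the unread input, and the output. -/
structure Store (α β : Type) where
  var : α → ℕ
  arr : β → ℕ → ℕ
  input : List ℕ
  output : List ℕ

variable {α β : Type}

def Expr.eval (n : ℕ) (σ : Store α β) : Expr α β → ℕ
  | size => n
  | const v => v
  | var x => σ.var x
  | add a b => a.eval n σ + b.eval n σ
  | sub a b => a.eval n σ - b.eval n σ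
  | get t a => σ.arr t (a.eval n σ)

/-- `forRange f n s` applies `f 0`, …, `f (n - 1)` to `s` one after the other. -/
def forRange {S : Type} (f : ℕ → S → S) : ℕ → S → S
  | 0, s => s
  | n + 1, s => f n (forRange f n s)

theorem forRange_induction {S : Type} {f : ℕ → S → S} {n : ℕ} {s : S} (P : ℕ → S → Prop)
    (zero : P 0 s) (succ : ∀ i s', i < n → P i s' → P (i + 1) (f i s')) :
    P n (forRange f n s) := by
  suffices ∀ i ≤ n, P i (forRange f i s) from this n le_rfl
  intro i
  induction i with
  | zero => exact fun _ => zero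
  | succ i ih => exact fun hi => succ i _ hi (ih (by omega))

section Eval

variable [DecidableEq α] [DecidableEq β]

def Store.setVar (σ : Store α β) (x : α) (v : ℕ) : Store α β :=
  { σ with var := Function.update σ.var x v }

def Store.setArr (σ : Store α β) (t : β) (i v : ℕ) : Store α β :=
  { σ with arr := Function.update σ.arr t (Function.update (σ.arr t) i v) }

def Cmd.eval (n : ℕ) : Cmd α β → Store α β → Store α β
  | skip => id
  | set x a => fun σ => σ.setVar x (a.eval n σ)
  | put t a b => fun σ => σ.setArr t (a.eval n σ) (b.eval n σ)
  | read x => fun σ => { σ.setVar x (σ.input.headD 0) with input := σ.input.tail }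
  | write a => fun σ => { σ with output := σ.output ++ [a.eval n σ] }
  | seq c d => fun σ => d.eval n (c.eval n σ)
  | ite a c d => fun σ => if a.eval n σ = 0 then d.eval n σ else c.eval n σ
  | loop x c => forRange (fun i σ => c.eval n (σ.setVar x i)) n

end Eval

/-- Registers for variables.  The register `0` holds the size. -/
def varReg (x : ℕ) : ℕ := 3 * x + 1

/-- Registers for intermediate results. -/
def tmpReg (d : ℕ) : ℕ := 3 * d + 2

/-- Registers for loop counters. -/
def ctrReg (d : ℕ) : ℕ := 3 * d + 3

/-- Turn the index in the register `tmpReg d` into an address; sixteen arrays are interleaved. -/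
def addrCode (t : Fin 16) (d : ℕ) : Program :=
  -- Four doublings stand in for a multiplication by 16.
  [.add (tmpReg d) (tmpReg d) (tmpReg d), .add (tmpReg d) (tmpReg d) (tmpReg d),
    .add (tmpReg d) (tmpReg d) (tmpReg d), .add (tmpReg d) (tmpReg d) (tmpReg d),
    .const (tmpReg (d + 1)) t, .add (tmpReg d) (tmpReg d) (tmpReg (d + 1))]

/-- Code that evaluates an expression into the register `tmpReg d`. -/
def Expr.compile (f : α → ℕ) (g : β → Fin 16) : Expr α β → ℕ → Program
  -- The machine has no copy instruction; copying is adding to zero. The last `0` is the register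
  -- that holds the size.
  | size, d => [.const (tmpReg d) 0, .add (tmpReg d) (tmpReg d) 0]
  | const v, d => [.const (tmpReg d) v]
  | var x, d => [.const (tmpReg d) 0, .add (tmpReg d) (tmpReg d) (varReg (f x))]
  | add a b, d => a.compile f g d ++ (b.compile f g (d + 1) ++
      [.add (tmpReg d) (tmpReg d) (tmpReg (d + 1))])
  | sub a b, d => a.compile f g d ++ (b.compile f g (d + 1) ++
      [.sub (tmpReg d) (tmpReg d) (tmpReg (d + 1))])
  | get t a, d => a.compile f g d ++ (addrCode (g t) d ++ [.load (tmpReg d) (tmpReg d)])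

/-- The code of a command at position `l` inside `d` loops. -/
def Cmd.compile (f : α → ℕ) (g : β → Fin 16) : Cmd α β → ℕ → ℕ → Program
  | skip, _, _ => []
  | set x a, _, _ => a.compile f g 0 ++
      [.const (varReg (f x)) 0, .add (varReg (f x)) (varReg (f x)) (tmpReg 0)]
  | put t a b, _, _ => a.compile f g 0 ++ (addrCode (g t) 0 ++ (b.compile f g 1 ++
      [.store (tmpReg 0) (tmpReg 1)]))
  | read x, _, _ => [.read (varReg (f x))]
  | write a, _, _ => a.compile f g 0 ++ [.write (tmpReg 0)]
  | seq c d, l, k =>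
      let A := c.compile f g l k
      A ++ d.compile f g (l + A.length) k
  | ite a c d, l, k =>
      let A := a.compile f g 0
      let B := c.compile f g (l + A.length + 1) k
      let D := d.compile f g (l + A.length + 1 + B.length + 1) k
      A ++ (.jumpIfZero (tmpReg 0) (l + A.length + 1 + B.length + 1) ::
        (B ++ (.jump (l + A.length + 1 + B.length + 1 + D.length) :: D)))
  -- A separate counter for each nesting depth runs down from the size, and `x` is recomputed from
  -- it in every round, so the body may overwrite `x` freely.
  | loop x c, l, k =>
      let B := c.compile f g (l + 4) (k + 1)
      [.const (ctrReg k) 0, .add (ctrReg k) (ctrReg k) 0,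
        .jumpIfZero (ctrReg k) (l + 4 + B.length + 3), .sub (varReg (f x)) 0 (ctrReg k)] ++
      (B ++ [.const (tmpReg 0) 1, .sub (ctrReg k) (ctrReg k) (tmpReg 0), .jump (l + 2)])

/-- An upper bound on the number of steps of a command, as a polynomial in the size. -/
noncomputable def Cmd.steps (f : α → ℕ) (g : β → Fin 16) : Cmd α β → Polynomial ℕ
  | seq c d => c.steps f g + d.steps f g
  | ite a c d => .C ((a.compile f g 0).length + 2) + c.steps f g + d.steps f g
  -- Two instructions set the counter and one performs the final test; each round adds a test, the
  -- assignment of the loop variable, and three instructions to decrement and jump back.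
  | loop _ c => .C 3 + .X * (c.steps f g + .C 5)
  | c => .C (c.compile f g 0 0).length

/-! ### Correctness of the compiler -/

/-- The program `P` contains the code `L` at position `l`. -/
def CodeAt (P : Program) (l : ℕ) (L : Program) : Prop :=
  ∀ i I, L[i]? = some I → P[l + i]? = some I

theorem codeAt_append {P A B : Program} {l : ℕ} :
    CodeAt P l (A ++ B) ↔ CodeAt P l A ∧ CodeAt P (l + A.length) B := by
  constructor
  · refine fun h => ⟨fun i I hi => h i I ?_, fun i I hi => ?_⟩
    · rw [List.getElem?_append_left (List.getElem?_eq_some_iff.1 hi).1, hi]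
    · rw [add_assoc]
      exact h _ I (by rwa [List.getElem?_append_right (by omega), Nat.add_sub_cancel_left])
  · rintro ⟨hA, hB⟩ i I hi
    by_cases h : i < A.length
    · exact hA i I (by rwa [List.getElem?_append_left h] at hi)
    · rw [List.getElem?_append_right (by omega)] at hi
      have := hB _ I hi
      rwa [show l + A.length + (i - A.length) = l + i by omega] at this

theorem codeAt_cons {P A : Program} {I : Instr} {l : ℕ} :
    CodeAt P l (I :: A) ↔ P[l]? = some I ∧ CodeAt P (l + 1) A := by
  rw [← List.singleton_append, codeAt_append]
  refine and_congr ⟨fun h => h 0 I rfl, fun h i J hi => ?_⟩ Iff.rfl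
  obtain ⟨hi', rfl⟩ := List.getElem?_eq_some_iff.1 hi
  obtain rfl : i = 0 := by simpa using hi'
  simpa using h

/-- The effect of straight-line code. -/
def execList (L : Program) (c : Config) : Config := L.foldl Instr.exec c

@[simp] theorem execList_nil (c : Config) : execList [] c = c := rfl

@[simp] theorem execList_cons (I : Instr) (L : Program) (c : Config) :
    execList (I :: L) c = execList L (I.exec c) := rfl

@[simp] theorem execList_append (A B : Program) (c : Config) :
    execList (A ++ B) c = execList B (execList A c) := List.foldl_append

/-- Instructions that go on to the next instruction. -/
def Instr.Straight (I : Instr) : Prop := ∀ c : Config, (I.exec c).pc = c.pc + 1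

theorem Steps.of_straight {P : Program} : ∀ (L : Program) (c : Config), CodeAt P c.pc L →
    (∀ I ∈ L, I.Straight) →
    Steps P c L.length (execList L c) ∧ (execList L c).pc = c.pc + L.length
  | [], c, _, _ => ⟨.refl c, rfl⟩
  | I :: L, c, hL, hs => by
    rw [codeAt_cons] at hL
    have hpc := hs I (by simp) c
    have := Steps.of_straight L (I.exec c) (by rw [hpc]; exact hL.2)
      fun J hJ => hs J (by simp [hJ])
    refine ⟨.step hL.1 this.1, ?_⟩
    rw [execList_cons, this.2, hpc, List.length_cons]
    omega

/-- The configuration `c` represents the store `σ`. -/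
structure Represents (f : α → ℕ) (g : β → Fin 16) (n : ℕ) (σ : Store α β) (c : Config) :
    Prop where
  size : c.reg 0 = n
  var : ∀ x, c.reg (varReg (f x)) = σ.var x
  arr : ∀ t i, c.mem (16 * i + g t) = σ.arr t i
  input : c.input = σ.input
  output : c.output = σ.output

/-- `c'` agrees with `c` except for the program counter and the registers `tmpReg e`, `d ≤ e`. -/
structure Config.AgreeUpTo (d : ℕ) (c c' : Config) : Prop where
  reg : ∀ i, (∀ e, d ≤ e → i ≠ tmpReg e) → c'.reg i = c.reg i
  mem : c'.mem = c.mem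
  input : c'.input = c.input
  output : c'.output = c.output

theorem Config.AgreeUpTo.trans {d e : ℕ} {c c' c'' : Config} (h : c.AgreeUpTo d c')
    (h' : c'.AgreeUpTo e c'') (hde : d ≤ e) : c.AgreeUpTo d c'' :=
  ⟨fun i hi => (h'.reg i fun e' he' => hi e' (hde.trans he')).trans (h.reg i hi),
    h'.mem.trans h.mem, h'.input.trans h.input, h'.output.trans h.output⟩

theorem Represents.of_agree {f : α → ℕ} {g : β → Fin 16} {n d : ℕ} {σ : Store α β}
    {c c' : Config} (h : Represents f g n σ c) (h' : c.AgreeUpTo d c') :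
    Represents f g n σ c' where
  size := by rw [h'.reg _ fun e _ => by simp [tmpReg], h.size]
  var x := by rw [h'.reg _ fun e _ => by simp only [varReg, tmpReg]; omega, h.var]
  arr t i := by rw [h'.mem, h.arr]
  input := h'.input.trans h.input
  output := h'.output.trans h.output

theorem addrCode_spec (t : Fin 16) (d : ℕ) (c : Config) :
    (execList (addrCode t d) c).reg (tmpReg d) = 16 * c.reg (tmpReg d) + t ∧
      c.AgreeUpTo d (execList (addrCode t d) c) := by
  have h : tmpReg d ≠ tmpReg (d + 1) := by simp only [tmpReg]; omega
  refine ⟨?_, fun i hi => ?_, rfl, rfl, rfl⟩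
  · simp [addrCode, Instr.exec, Config.assign, h]
    omega
  · have h₁ := hi d le_rfl
    have h₂ := hi (d + 1) (by omega)
    simp [addrCode, Instr.exec, Config.assign, h₁, h₂]

/-- The second operand is evaluated one temporary register higher and disturbs only registers from
there on. Hence the value of the first operand survives, which is why agreement is tracked from
depth `d` upwards. -/
theorem Expr.compile_spec {f : α → ℕ} {g : β → Fin 16} {n : ℕ} {σ : Store α β} (a : Expr α β) :
    ∀ (d : ℕ) (c : Config), Represents f g n σ c →
      (execList (a.compile f g d) c).reg (tmpReg d) = a.eval n σ ∧
        c.AgreeUpTo d (execList (a.compile f g d) c) := by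
  have hne (d : ℕ) : tmpReg d ≠ tmpReg (d + 1) := by simp only [tmpReg]; omega
  have hup (c : Config) (d v : ℕ) : c.AgreeUpTo d (c.assign (tmpReg d) v) :=
    ⟨fun i hi => by simp [Config.assign, hi d le_rfl], rfl, rfl, rfl⟩
  induction a with
  | size =>
    intro d c hc
    refine ⟨?_, (hup _ d _).trans (hup _ d _) le_rfl⟩
    have : (0 : ℕ) ≠ tmpReg d := by simp [tmpReg]
    simp [Expr.compile, Instr.exec, Config.assign, Expr.eval, hc.size, this]
  | const v =>
    intro d c hc
    exact ⟨by simp [Expr.compile, Instr.exec, Config.assign, Expr.eval], hup _ d _⟩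
  | var x =>
    intro d c hc
    refine ⟨?_, (hup _ d _).trans (hup _ d _) le_rfl⟩
    have : varReg (f x) ≠ tmpReg d := by simp only [varReg, tmpReg]; omega
    simp [Expr.compile, Instr.exec, Config.assign, Expr.eval, hc.var, this]
  | add a b iha ihb =>
    intro d c hc
    obtain ⟨ha, ha'⟩ := iha d c hc
    obtain ⟨hb, hb'⟩ := ihb (d + 1) _ (hc.of_agree ha')
    have : (execList (b.compile f g (d + 1)) (execList (a.compile f g d) c)).reg (tmpReg d) =
        a.eval n σ := by
      rw [hb'.reg _ fun e he => by simp only [tmpReg]; omega, ha]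
    refine ⟨?_, (ha'.trans hb' (by omega)).trans
      (by simpa [Expr.compile, Instr.exec] using hup _ d _) le_rfl⟩
    simp [Expr.compile, Instr.exec, Config.assign, Expr.eval, hb, this]
  | sub a b iha ihb =>
    intro d c hc
    obtain ⟨ha, ha'⟩ := iha d c hc
    obtain ⟨hb, hb'⟩ := ihb (d + 1) _ (hc.of_agree ha')
    have : (execList (b.compile f g (d + 1)) (execList (a.compile f g d) c)).reg (tmpReg d) =
        a.eval n σ := by
      rw [hb'.reg _ fun e he => by simp only [tmpReg]; omega, ha]
    refine ⟨?_, (ha'.trans hb' (by omega)).trans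
      (by simpa [Expr.compile, Instr.exec] using hup _ d _) le_rfl⟩
    simp [Expr.compile, Instr.exec, Config.assign, Expr.eval, hb, this]
  | get t a ih =>
    intro d c hc
    obtain ⟨ha, ha'⟩ := ih d c hc
    obtain ⟨hb, hb'⟩ := addrCode_spec (g t) d (execList (a.compile f g d) c)
    refine ⟨?_, (ha'.trans hb' le_rfl).trans
      (by simpa [Expr.compile, Instr.exec] using hup _ d _) le_rfl⟩
    simp [Expr.compile, Instr.exec, Config.assign, Expr.eval, hb, ha, hb'.mem, ha'.mem, hc.arr]

theorem addrCode_straight (t : Fin 16) (d : ℕ) : ∀ I ∈ addrCode t d, I.Straight := by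
  simp [addrCode, Instr.Straight, Instr.exec, Config.assign]

theorem Expr.compile_straight (f : α → ℕ) (g : β → Fin 16) (a : Expr α β) :
    ∀ d, ∀ I ∈ a.compile f g d, I.Straight := by
  induction a with
  | size => simp [Expr.compile, Instr.Straight, Instr.exec, Config.assign]
  | const v => simp [Expr.compile, Instr.Straight, Instr.exec, Config.assign]
  | var x => simp [Expr.compile, Instr.Straight, Instr.exec, Config.assign]
  | add a b iha ihb =>
    intro d I hI
    simp only [Expr.compile, List.mem_append, List.mem_singleton] at hI
    rcases hI with h | h | rfl
    exacts [iha _ I h, ihb _ I h, fun _ => rfl]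
  | sub a b iha ihb =>
    intro d I hI
    simp only [Expr.compile, List.mem_append, List.mem_singleton] at hI
    rcases hI with h | h | rfl
    exacts [iha _ I h, ihb _ I h, fun _ => rfl]
  | get t a ih =>
    intro d I hI
    simp only [Expr.compile, List.mem_append, List.mem_singleton] at hI
    rcases hI with h | h | rfl
    exacts [ih _ I h, addrCode_straight _ _ I h, fun _ => rfl]

end RAM
namespace RAM
variable {α β : Type}

theorem Represents.setVar [DecidableEq α] {f : α → ℕ} {g : β → Fin 16} (hf : f.Injective) {n : ℕ}
    {σ : Store α β} {c c' : Config} (h : Represents f g n σ c) (x : α) (v : ℕ)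
    (hr : ∀ i, (∀ e, i ≠ tmpReg e) → i ≠ varReg (f x) → c'.reg i = c.reg i)
    (hx : c'.reg (varReg (f x)) = v) (hm : c'.mem = c.mem) (hi : c'.input = c.input)
    (ho : c'.output = c.output) : Represents f g n (σ.setVar x v) c' where
  size := by
    rw [hr 0 (fun e => by simp [tmpReg]) (by simp [varReg]), h.size]
  var y := by
    by_cases hy : y = x
    · subst hy
      simp [Store.setVar, hx]
    · have : varReg (f y) ≠ varReg (f x) := by
        have := hf.ne hy
        simp only [varReg]
        omega
      rw [hr _ (fun e => by simp only [varReg, tmpReg]; omega) this, h.var]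
      simp [Store.setVar, hy]
  arr t i := by rw [hm, h.arr]; rfl
  input := by rw [hi, h.input]; rfl
  output := by rw [ho, h.output]; rfl

theorem Represents.setArr [DecidableEq β] {f : α → ℕ} {g : β → Fin 16} (hg : g.Injective) {n : ℕ}
    {σ : Store α β} {c c' : Config} (h : Represents f g n σ c) (t : β) (i v : ℕ)
    (hr : c'.reg = c.reg) (hm : c'.mem = Function.update c.mem (16 * i + g t) v)
    (hi : c'.input = c.input) (ho : c'.output = c.output) :
    Represents f g n (σ.setArr t i v) c' where
  size := by rw [hr, h.size]
  var y := by rw [hr, h.var]; rfl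
  arr t' i' := by
    rw [hm]
    by_cases ht : t' = t
    · subst ht
      by_cases hi' : i' = i
      · subst hi'
        simp [Store.setArr]
      · simp [Store.setArr, hi', h.arr]
    · have : (g t' : ℕ) ≠ g t := fun e => ht (hg (Fin.ext e))
      have : 16 * i' + (g t' : ℕ) ≠ 16 * i + g t := by omega
      simp [Store.setArr, Function.update_of_ne this, ht, h.arr]
  input := by rw [hi, h.input]; rfl
  output := by rw [ho, h.output]; rfl

/-- The outcome of running the code of a command: it ends behind the code, within the given number
of steps, and leaves the counters of the surrounding loops alone. -/
def Simulates (f : α → ℕ) (g : β → Fin 16) (n : ℕ) (P : Program) (c : Config) (σ' : Store α β)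
    (e k T : ℕ) : Prop :=
  ∃ t c', Steps P c t c' ∧ t ≤ T ∧ Represents f g n σ' c' ∧ c'.pc = e ∧
    ∀ k' < k, c'.reg (ctrReg k') = c.reg (ctrReg k')

/-- Induction on the command. Variables, temporaries and counters live in different residue classes
of registers modulo 3, so they never collide. Preservation of the outer counters is carried along
because the loop case needs its own counter intact after the body. -/
theorem Cmd.compile_spec [DecidableEq α] [DecidableEq β] {f : α → ℕ} {g : β → Fin 16}
    (hf : f.Injective) (hg : g.Injective) {n : ℕ} {P : Program} (C : Cmd α β) :
    ∀ (l k : ℕ) (σ : Store α β) (c : Config), CodeAt P l (C.compile f g l k) →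
      Represents f g n σ c → c.pc = l →
      Simulates f g n P c (C.eval n σ) (l + (C.compile f g l k).length) k
        ((C.steps f g).eval n) := by
  have hct (k e : ℕ) : ctrReg k ≠ tmpReg e := by simp only [ctrReg, tmpReg]; omega
  have hcv (k x : ℕ) : ctrReg k ≠ varReg x := by simp only [ctrReg, varReg]; omega
  have hcc {k k' : ℕ} (h : k' < k) : ctrReg k' ≠ ctrReg k := by simp only [ctrReg]; omega
  have hvc (k x : ℕ) : varReg x ≠ ctrReg k := (hcv k x).symm
  have hvt (x e : ℕ) : varReg x ≠ tmpReg e := by simp only [tmpReg, varReg]; omega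
  have hzc (k : ℕ) : 0 ≠ ctrReg k := by simp [ctrReg]
  have hzt (k : ℕ) : 0 ≠ tmpReg k := by simp [tmpReg]
  have single {e : ℕ} {I : Instr} {c : Config} (h : P[e]? = some I) (hc : c.pc = e) :
      Steps P c 1 (I.exec c) := .single (by rwa [hc])
  have expr (a : Expr α β) (l d : ℕ) (σ : Store α β) (c : Config)
      (hP : CodeAt P l (a.compile f g d)) (hR : Represents f g n σ c) (hl : c.pc = l) :
      ∃ c', Steps P c (a.compile f g d).length c' ∧ c'.reg (tmpReg d) = a.eval n σ ∧
        c.AgreeUpTo d c' ∧ c'.pc = l + (a.compile f g d).length := by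
    subst hl
    have h₁ := Steps.of_straight _ c hP (a.compile_straight f g d)
    have h₂ := a.compile_spec d c hR
    exact ⟨_, h₁.1, h₂.1, h₂.2, h₁.2⟩
  induction C with
  | skip =>
    intro l k σ c _ hR hl
    exact ⟨0, c, .refl c, by simp, hR, by simp [Cmd.compile, hl], fun _ _ => rfl⟩
  | set x a =>
    intro l k σ c hP hR hl
    simp only [Cmd.compile, codeAt_append] at hP
    obtain ⟨c₁, hs₁, hv₁, hA₁, hl₁⟩ := expr a l 0 σ c hP.1 hR hl
    rw [← hl₁] at hP
    have hs₂ := Steps.of_straight _ c₁ hP.2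
      (by simp [Instr.Straight, Instr.exec, Config.assign])
    refine ⟨_, _, hs₁.trans hs₂.1, by simp [Cmd.steps, Cmd.compile],
      (hR.of_agree hA₁).setVar hf x _ ?_ ?_ rfl rfl rfl, ?_, ?_⟩
    · intro i _ hi
      simp [Instr.exec, Config.assign, hi]
    · simp [Instr.exec, Config.assign, (hvt _ _).symm, hv₁]
    · rw [hs₂.2, hl₁]
      simp [Cmd.compile, add_assoc]
    · intro k' _
      rw [← hA₁.reg _ fun e _ => hct k' e]
      simp [Instr.exec, Config.assign, hcv]
  | put t a b =>
    intro l k σ c hP hR hl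
    simp only [Cmd.compile, codeAt_append] at hP
    obtain ⟨hPa, hPd, hPb, hPs⟩ := hP
    obtain ⟨c₁, hs₁, hv₁, hA₁, hl₁⟩ := expr a l 0 σ c hPa hR hl
    rw [← hl₁] at hPd hPb hPs
    have hs₂ := Steps.of_straight _ c₁ hPd (addrCode_straight (g t) 0)
    obtain ⟨hv₂, hA₂⟩ := addrCode_spec (g t) 0 c₁
    have hR₂ := (hR.of_agree hA₁).of_agree hA₂
    obtain ⟨c₃, hs₃, hv₃, hA₃, hl₃⟩ := expr b _ 1 σ _ hPb hR₂ hs₂.2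
    rw [← hl₃, codeAt_cons] at hPs
    refine ⟨_, _, ((hs₁.trans hs₂.1).trans hs₃).trans (.single hPs.1),
      by simp [Cmd.steps, Cmd.compile]; omega,
      (hR₂.of_agree hA₃).setArr hg t (a.eval n σ) (b.eval n σ) rfl ?_ rfl rfl, ?_, ?_⟩
    · have : c₃.reg (tmpReg 0) = 16 * a.eval n σ + g t := by
        rw [hA₃.reg _ fun e he => by simp only [tmpReg]; omega, hv₂, hv₁]
      simp [Instr.exec, this, hv₃]
    · simp [Instr.exec, hl₃, hl₁, Cmd.compile]
      omega
    · intro k' _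
      rw [← hA₁.reg _ fun e _ => hct k' e, ← hA₂.reg _ fun e _ => hct k' e,
        ← hA₃.reg _ fun e _ => hct k' e]
      rfl
  | read x =>
    intro l k σ c hP hR hl
    simp only [Cmd.compile, codeAt_cons] at hP
    rw [← hl] at hP
    have := hR.setVar (c' := c.assign (varReg (f x)) (c.input.headD 0)) hf x (σ.input.headD 0)
      (fun i _ hi => by simp [Config.assign, hi]) (by simp [Config.assign, hR.input]) rfl rfl rfl
    refine ⟨_, _, .single hP.1, by simp [Cmd.steps, Cmd.compile],
      ⟨this.size, this.var, this.arr, ?_, this.output⟩, ?_, ?_⟩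
    · simp [Instr.exec, Cmd.eval, hR.input]
    · simp [Instr.exec, Config.assign, hl, Cmd.compile]
    · intro k' _
      simp [Instr.exec, Config.assign, hcv]
  | write a =>
    intro l k σ c hP hR hl
    simp only [Cmd.compile, codeAt_append] at hP
    obtain ⟨c₁, hs₁, hv₁, hA₁, hl₁⟩ := expr a l 0 σ c hP.1 hR hl
    rw [← hl₁, codeAt_cons] at hP
    have hR₁ := hR.of_agree hA₁
    refine ⟨_, _, hs₁.trans (.single hP.2.1), by simp [Cmd.steps, Cmd.compile],
      ⟨hR₁.size, hR₁.var, hR₁.arr, hR₁.input, ?_⟩, ?_, ?_⟩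
    · simp [Instr.exec, Cmd.eval, hR₁.output, hv₁]
    · simp [Instr.exec, hl₁, Cmd.compile, add_assoc]
    · intro k' _
      rw [← hA₁.reg _ fun e _ => hct k' e]
      rfl
  | seq C D ihC ihD =>
    intro l k σ c hP hR hl
    simp only [Cmd.compile, codeAt_append] at hP
    obtain ⟨t₁, c₁, hs₁, ht₁, hR₁, hl₁, hk₁⟩ := ihC l k σ c hP.1 hR hl
    obtain ⟨t₂, c₂, hs₂, ht₂, hR₂, hl₂, hk₂⟩ := ihD _ k _ c₁ hP.2 hR₁ hl₁
    refine ⟨_, c₂, hs₁.trans hs₂, ?_, hR₂, ?_, fun k' hk' => (hk₂ k' hk').trans (hk₁ k' hk')⟩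
    · simp only [Cmd.steps, Polynomial.eval_add]
      omega
    · simp [Cmd.compile, hl₂, add_assoc]
  | ite a C D ihC ihD =>
    intro l k σ c hP hR hl
    simp only [Cmd.compile, codeAt_append, codeAt_cons] at hP
    obtain ⟨hPa, hPj, hPC, hPj', hPD⟩ := hP
    obtain ⟨c₁, hs₁, hv₁, hA₁, hl₁⟩ := expr a l 0 σ c hPa hR hl
    have hR₁ := hR.of_agree hA₁
    have hs₂ := hs₁.trans (single hPj hl₁)
    simp only [Cmd.eval, Cmd.steps, Polynomial.eval_add, Polynomial.eval_C]
    by_cases h0 : a.eval n σ = 0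
    · rw [if_pos h0]
      obtain ⟨t₃, c₃, hs₃, ht₃, hR₃, hl₃, hk₃⟩ := ihD _ k σ
        ((Instr.jumpIfZero (tmpReg 0) (l + (a.compile f g 0).length + 1 +
          (C.compile f g (l + (a.compile f g 0).length + 1) k).length + 1)).exec c₁) hPD
        ⟨hR₁.size, hR₁.var, hR₁.arr, hR₁.input, hR₁.output⟩ (by simp [Instr.exec, hv₁, h0])
      refine ⟨_, c₃, hs₂.trans hs₃, by omega, hR₃, ?_, fun k' hk' => ?_⟩
      · simp [Cmd.compile, hl₃]
        omega
      · rw [hk₃ k' hk', ← hA₁.reg _ fun e _ => hct k' e]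
        rfl
    · rw [if_neg h0]
      obtain ⟨t₃, c₃, hs₃, ht₃, hR₃, hl₃, hk₃⟩ := ihC _ k σ
        ((Instr.jumpIfZero (tmpReg 0) (l + (a.compile f g 0).length + 1 +
          (C.compile f g (l + (a.compile f g 0).length + 1) k).length + 1)).exec c₁) hPC
        ⟨hR₁.size, hR₁.var, hR₁.arr, hR₁.input, hR₁.output⟩ (by simp [Instr.exec, hv₁, h0, hl₁])
      refine ⟨_, _, (hs₂.trans hs₃).trans (single hPj' hl₃), by omega,
        ⟨hR₃.size, hR₃.var, hR₃.arr, hR₃.input, hR₃.output⟩, ?_, fun k' hk' => ?_⟩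
      · simp [Cmd.compile, Instr.exec]
        omega
      · rw [← hA₁.reg _ fun e _ => hct k' e]
        exact hk₃ k' hk'
  | loop x C ih =>
    intro l k σ c hP hR hl
    simp only [Cmd.compile, codeAt_append, codeAt_cons] at hP
    obtain ⟨⟨hP₀, hP₁, hP₂, hP₃, -⟩, hPC, hP₄, hP₅, hP₆, -⟩ := hP
    simp only [List.length_cons, List.length_nil, zero_add, add_assoc, Nat.reduceAdd] at *
    set B := C.compile f g (l + 4) (k + 1) with hB
    have start : ∃ c', Steps P c 2 c' ∧ Represents f g n σ c' ∧ c'.pc = l + 2 ∧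
        c'.reg (ctrReg k) = n ∧ ∀ k' < k, c'.reg (ctrReg k') = c.reg (ctrReg k') := by
      subst hl
      refine ⟨_, .step hP₀ (.single hP₁), ⟨?_, ?_, hR.arr, hR.input, hR.output⟩, rfl, ?_, ?_⟩
      · simpa [Instr.exec, Config.assign, hzc] using hR.size
      · simpa [Instr.exec, Config.assign, hvc] using hR.var
      · simp [Instr.exec, Config.assign, hzc, hR.size]
      · intro k' hk'
        simp [Instr.exec, Config.assign, hcc hk']
    -- After `i` rounds control is back at the loop test, at `l + 2`, with counter `n - i`.
    have main : ∀ i ≤ n, ∃ t c', Steps P c t c' ∧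
        t ≤ 2 + i * ((C.steps f g).eval n + 5) ∧
        Represents f g n (forRange (fun i σ => C.eval n (σ.setVar x i)) i σ) c' ∧
        c'.pc = l + 2 ∧ c'.reg (ctrReg k) = n - i ∧
        ∀ k' < k, c'.reg (ctrReg k') = c.reg (ctrReg k') := by
      intro i
      induction i with
      | zero =>
        obtain ⟨c', h₁, h₂, h₃, h₄, h₅⟩ := start
        exact fun _ => ⟨2, c', h₁, by simp, h₂, h₃, h₄, h₅⟩
      | succ i ihi =>
        intro hi
        obtain ⟨t, c₁, hs₁, ht₁, hR₁, hl₁, hc₁, hk₁⟩ := ihi (by omega)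
        rw [← hl₁] at hP₂
        have hs₂ := hs₁.trans (.single hP₂)
        set c₂ := (Instr.jumpIfZero (ctrReg k) (l + (4 + (B.length + 3)))).exec c₁ with hc₂
        have hl₂ : c₂.pc = l + 3 := by
          have : n - i ≠ 0 := by omega
          simp [hc₂, Instr.exec, hc₁, this, hl₁]
        rw [← hl₂] at hP₃
        have hs₃ := hs₂.trans (.single hP₃)
        have hR₂ : Represents f g n _ c₂ :=
          ⟨hR₁.size, hR₁.var, hR₁.arr, hR₁.input, hR₁.output⟩
        have hR₃ := hR₂.setVar (c' := (Instr.sub (varReg (f x)) 0 (ctrReg k)).exec c₂) hf x i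
          (fun i _ hi => by simp [Instr.exec, Config.assign, hi])
          (by
            have h₀ : c₂.reg 0 = n := hR₂.size
            have h₁ : c₂.reg (ctrReg k) = n - i := hc₁
            simp [Instr.exec, Config.assign, h₀, h₁]
            omega) rfl rfl rfl
        obtain ⟨t₄, c₄, hs₄, ht₄, hR₄, hl₄, hk₄⟩ := ih (l + 4) (k + 1) _ _ hPC hR₃
          (by simp [Instr.exec, Config.assign, hl₂])
        have hl₄' : c₄.pc = l + (4 + B.length) := by rw [hl₄, add_assoc]
        rw [← hl₄'] at hP₄
        have hs₅ := (hs₃.trans hs₄).trans (.single hP₄)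
        set c₅ := (Instr.const (tmpReg 0) 1).exec c₄ with hc₅
        have hl₅ : c₅.pc = l + (4 + (B.length + 1)) := by
          simp [hc₅, Instr.exec, Config.assign, hl₄']
          omega
        rw [← hl₅] at hP₅
        have hs₆ := hs₅.trans (.single hP₅)
        set c₆ := (Instr.sub (ctrReg k) (ctrReg k) (tmpReg 0)).exec c₅ with hc₆
        have hl₆ : c₆.pc = l + (4 + (B.length + 2)) := by
          simp [hc₆, Instr.exec, Config.assign, hl₅]
          omega
        rw [← hl₆] at hP₆
        refine ⟨_, _, hs₆.trans (.single hP₆), ?_,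
          ⟨?_, ?_, hR₄.arr, hR₄.input, hR₄.output⟩, rfl, ?_, ?_⟩
        · rw [Nat.succ_mul]
          omega
        · simpa [hc₆, hc₅, Instr.exec, Config.assign, hzc, hzt] using hR₄.size
        · simpa [hc₆, hc₅, Instr.exec, Config.assign, hvc, hvt, forRange] using hR₄.var
        · have : c₄.reg (ctrReg k) = n - i := by
            rw [hk₄ k (by omega), ← hc₁]
            simp [hc₂, Instr.exec, Config.assign, hcv]
          simp [hc₆, hc₅, Instr.exec, Config.assign, hct, this]
          omega
        · intro k' hk'
          rw [← hk₁ k' hk']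
          simp [hc₆, hc₅, Instr.exec, Config.assign, hct, hcc hk', hk₄ k' (by omega), hcv, hc₂]
    obtain ⟨t, c₁, hs₁, ht₁, hR₁, hl₁, hc₁, hk₁⟩ := main n le_rfl
    rw [← hl₁] at hP₂
    refine ⟨_, _, hs₁.trans (.single hP₂), ?_,
      ⟨hR₁.size, hR₁.var, hR₁.arr, hR₁.input, hR₁.output⟩, ?_, hk₁⟩
    · simp only [Cmd.steps, Polynomial.eval_add, Polynomial.eval_mul, Polynomial.eval_C,
        Polynomial.eval_X]
      omega
    · simp [Instr.exec, hc₁, Cmd.compile, ← hB]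
      omega

/-! ### From commands to polynomial time -/

/-- The empty store, with the given input. -/
def Store.ofInput (w : List ℕ) : Store α β where
  var := fun _ => 0
  arr := fun _ _ => 0
  input := w
  output := []

theorem length_le_inputSize (w : List ℕ) : w.length ≤ inputSize w := by
  induction w with
  | nil => simp
  | cons a w ih =>
    simp only [inputSize, List.map_cons, List.sum_cons, List.length_cons] at *
    omega

/-- A problem is solvable in polynomial time if a command of the structured language solves it,
where the first number of the input is the size of the instance and is at most the length of the
input. -/
theorem SolvableInPolyTime.of_cmd [DecidableEq α] [DecidableEq β] {f : α → ℕ} {g : β → Fin 16}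
    (hf : f.Injective) (hg : g.Injective) {γ : Type} {enc : γ → List ℕ}
    {good : γ → List ℕ → Prop} (C : Cmd α β)
    (h : ∀ x, ∃ n w, enc x = n :: w ∧ n ≤ w.length ∧
      good x (C.eval n (Store.ofInput w)).output) :
    SolvableInPolyTime enc good := by
  -- The first instruction loads the size into register `0`; the compiled code therefore starts at
  -- position 1.
  set P : Program := .read 0 :: C.compile f g 1 0 with hP
  obtain ⟨M, hM⟩ : ∃ M, ∀ i v, Instr.const i v ∈ P → v.size ≤ M := by
    generalize P = P
    induction P with
    | nil => exact ⟨0, by simp⟩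
    | cons I P ih =>
      obtain ⟨M, hM⟩ := ih
      -- The cost of a `const` instruction exceeds the size of its constant; for other instructions
      -- the summand is harmless.
      refine ⟨M + I.cost (Config.init []), fun i v hv => ?_⟩
      rcases List.mem_cons.1 hv with rfl | hv
      · simp only [Instr.cost]
        omega
      · exact (hM i v hv).trans (by omega)
  refine ⟨P, (C.steps f g + 1) * (1 + 2 * (.X + .C M + (C.steps f g + 1))), fun x => ?_⟩
  obtain ⟨n, w, hx, hn, hgood⟩ := h x
  have hR : Represents f g n (Store.ofInput w) ((Instr.read 0).exec (Config.init (enc x))) := by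
    refine ⟨?_, fun y => ?_, fun t i => rfl, ?_, rfl⟩
    · simp [Instr.exec, Config.assign, Config.init, hx]
    · have : varReg (f y) ≠ 0 := by simp [varReg]
      simp [Instr.exec, Config.assign, Config.init, this, Store.ofInput]
    · simp [Instr.exec, Config.assign, Config.init, hx, Store.ofInput]
  obtain ⟨t, c, hs, ht, hR', hl, -⟩ := C.compile_spec hf hg (P := P) 1 0 _ _
    (fun i I hi => by rwa [add_comm, hP, List.getElem?_cons_succ]) hR rfl
  have hs' := Steps.step (P := P) (c := Config.init (enc x)) (I := .read 0) (by rfl) hs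
  obtain ⟨t', ht', hr⟩ := hs'.runs (M := inputSize (enc x) + M)
    (by rw [hl]; simp [hP])
    ((Config.bounded_init _).mono (by omega)) fun i v hv => (hM i v hv).trans (by omega)
  refine ⟨t', _, ⟨c, hr, rfl⟩, ht'.trans ?_, ?_⟩
  -- A number in binary may be exponential in its length; here `n` is small because the input has at
  -- least `n` entries. Polynomials over ℕ are monotone, so the step bound carries over to the input
  -- size.
  · have hn' : n ≤ inputSize (enc x) := by
      have := length_le_inputSize (enc x)
      simp only [hx, List.length_cons] at this ⊢
      omega
    have hm : (C.steps f g).eval n ≤ (C.steps f g).eval (inputSize (enc x)) := by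
      generalize C.steps f g = q
      rw [Polynomial.eval_eq_sum, Polynomial.eval_eq_sum]
      exact Finset.sum_le_sum fun i _ => Nat.mul_le_mul_left _ (Nat.pow_le_pow_left hn' i)
    simp only [Polynomial.eval_mul, Polynomial.eval_add, Polynomial.eval_C, Polynomial.eval_X,
      Polynomial.eval_one, Polynomial.eval_ofNat]
    gcongr <;> omega
  · rwa [hR'.output]

end RAM
namespace JRP

/-! ### The dynamic program

Jobs are numbered `0, …, n - 1` by nondecreasing release date `r`, and `p` gives the processing
times; `r n` exceeds all release dates.  `F` is a bound on the flow times. -/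

section DynamicProgram

variable {r p : ℕ → ℕ} {n F : ℕ}

/-- The recursion of `latest`, by the number of jobs. -/
def latestAux (r p : ℕ → ℕ) (F : ℕ) (d : ℕ → ℕ) (e : ℕ) : ℕ → ℕ
  | 0 => d e
  -- Strict bounds let `0` mean that no time is possible, and truncated subtraction produces this
  -- `0` by itself when the job cannot meet its bound. The `+ 1` makes the deadline `F + r` strict.
  | j + 1 => min (latestAux r p F d e j) (F + r (e - (j + 1)) + 1) - p (e - (j + 1))

/-- If the jobs `i, …, e - 1` are processed without idle time from time `t` on, then their flow
times are at most `F` and the last one is completed before `d e` if and only if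
`t < latest r p F d e i`. -/
def latest (r p : ℕ → ℕ) (F : ℕ) (d : ℕ → ℕ) (e i : ℕ) : ℕ := latestAux r p F d e (e - i)

theorem latest_self (d : ℕ → ℕ) (e : ℕ) : latest r p F d e e = d e := by
  simp [latest, latestAux]

theorem latest_of_lt (d : ℕ → ℕ) {e i : ℕ} (h : i < e) :
    latest r p F d e i = min (latest r p F d e (i + 1)) (F + r i + 1) - p i := by
  have h₁ : e - i = e - (i + 1) + 1 := by omega
  have h₂ : e - (e - (i + 1) + 1) = i := by omega
  rw [latest, latest, h₁, latestAux, h₂]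

theorem lt_latest (d : ℕ → ℕ) {e i C : ℕ} (hie : i ≤ e)
    (h : ∀ l, i ≤ l → l < e → C + ∑ x ∈ Finset.Ico i (l + 1), p x ≤ F + r l)
    (hd : C + ∑ x ∈ Finset.Ico i e, p x < d e) : C < latest r p F d e i := by
  obtain ⟨j, rfl⟩ := Nat.exists_eq_add_of_le hie
  induction j generalizing i C with
  | zero => simpa [latest_self] using hd
  | succ j ih =>
    have hi := h i le_rfl (by omega)
    have := @ih (i + 1) (C + p i) (by omega) (fun l hl hl' => ?_) ?_
    · rw [latest_of_lt _ (by omega)]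
      rw [show i + 1 + j = i + (j + 1) by omega] at this
      simp at hi
      omega
    · have := h l (by omega) (by omega)
      rwa [Finset.sum_eq_sum_Ico_succ_bot (by omega), ← add_assoc] at this
    · rw [Finset.sum_eq_sum_Ico_succ_bot (by omega)] at hd
      rwa [show i + 1 + j = i + (j + 1) by omega, add_assoc]

/-- `Good r p n F m i C`: if the jobs before `i` are completed at time `C`, then the other jobs can
be processed in order, in `m` batches, with flow times at most `F`.  The resource is replenished for
each batch at the release date of its last job. -/
def Good (r p : ℕ → ℕ) (n F : ℕ) : ℕ → ℕ → ℕ → Prop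
  | 0, i, _ => i = n
  -- The condition `r (e - 1) < r e` never separates jobs with equal release dates, so replenishment
  -- times increase strictly; at `e = n` it relies on the sentinel `r n`.
  | m + 1, i, C => ∃ e, i < e ∧ e ≤ n ∧ r (e - 1) < r e ∧
      (∀ l, i ≤ l → l < e →
        max C (r (e - 1)) + ∑ x ∈ Finset.Ico i (l + 1), p x ≤ F + r l) ∧
      Good r p n F m e (max C (r (e - 1)) + ∑ x ∈ Finset.Ico i e, p x)

theorem Good.add_le {m i C : ℕ} (h : Good r p n F m i C) : m + i ≤ n := by
  induction m generalizing i C with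
  | zero => simp only [Good] at h; omega
  | succ m ih =>
    obtain ⟨e, he, -, -, -, h⟩ := h
    have := ih h
    omega

/-- One layer of the dynamic program: `d' i` is a bound on the completion time of the jobs before
`i`, when the bounds `d` hold after one further batch, and `nx i` is the end of this batch.  The
batches `i, …, e - 1` with `proc e i` have been taken into account. -/
structure LayerStep (r p : ℕ → ℕ) (n F : ℕ) (proc : ℕ → ℕ → Prop) (d d' nx : ℕ → ℕ) : Prop where
  -- The batch starts at the maximum of `C` and `r (e - 1)`, which is below the latest start iff
  -- both are. So a batch admits either no `C` or all `C` below one bound, and only the largest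
  -- bound matters.
  le : ∀ e i, i < e → e ≤ n → proc e i → r (e - 1) < r e → r (e - 1) < latest r p F d e i →
    latest r p F d e i ≤ d' i
  next : ∀ i ≤ n, 0 < d' i → i < nx i ∧ nx i ≤ n ∧ r (nx i - 1) < r (nx i) ∧
    r (nx i - 1) < latest r p F d (nx i) i ∧ d' i = latest r p F d (nx i) i

theorem LayerStep.congr {proc proc' : ℕ → ℕ → Prop} {d d₁ d' d₁' nx nx₁ : ℕ → ℕ}
    (h : LayerStep r p n F proc d d' nx)
    (hproc : ∀ e i, i < e → e ≤ n → proc' e i → proc e i)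
    (hd : ∀ i ≤ n, d₁ i = d i) (hd' : ∀ i ≤ n, d₁' i = d' i) (hnx : ∀ i ≤ n, nx₁ i = nx i) :
    LayerStep r p n F proc' d₁ d₁' nx₁ := by
  have hl : ∀ e i, e ≤ n → latest r p F d₁ e i = latest r p F d e i := by
    intro e i he
    have : ∀ j, latestAux r p F d₁ e j = latestAux r p F d e j := by
      intro j
      induction j with
      | zero => exact hd e he
      | succ j ih => rw [latestAux, latestAux, ih]
    exact this _
  refine ⟨fun e i hie he hp h₁ h₂ => ?_, fun i hi h₁ => ?_⟩
  · rw [hl _ _ he] at h₂ ⊢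
    rw [hd' i (by omega)]
    exact h.le e i hie he (hproc e i hie he hp) h₁ h₂
  · rw [hd' i hi] at h₁ ⊢
    have := h.next i hi h₁
    rwa [hnx i hi, hl _ _ this.2.1]

/-- Taking a further batch into account, when it does not improve the bound. -/
theorem LayerStep.skip {proc proc' : ℕ → ℕ → Prop} {d d' nx : ℕ → ℕ} {e i : ℕ}
    (h : LayerStep r p n F proc d d' nx)
    (hproc : ∀ e' i', i' < e' → proc' e' i' → proc e' i' ∨ e' = e ∧ i' = i)
    (hx : r (e - 1) < r e → r (e - 1) < latest r p F d e i → latest r p F d e i ≤ d' i) :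
    LayerStep r p n F proc' d d' nx := by
  refine ⟨fun e' i' hie he hp h₁ h₂ => ?_, h.next⟩
  rcases hproc e' i' hie hp with hp | ⟨rfl, rfl⟩
  · exact h.le e' i' hie he hp h₁ h₂
  · exact hx h₁ h₂

/-- Taking a further batch into account, when it improves the bound. -/
theorem LayerStep.update {proc proc' : ℕ → ℕ → Prop} {d d' nx : ℕ → ℕ} {e i : ℕ}
    (h : LayerStep r p n F proc d d' nx)
    (hproc : ∀ e' i', i' < e' → proc' e' i' → proc e' i' ∨ e' = e ∧ i' = i)
    (hie : i < e) (he : e ≤ n) (h₁ : r (e - 1) < r e) (h₂ : r (e - 1) < latest r p F d e i)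
    (h₃ : d' i < latest r p F d e i) :
    LayerStep r p n F proc' d (Function.update d' i (latest r p F d e i))
      (Function.update nx i e) := by
  refine ⟨fun e' i' hie' he' hp h₁' h₂' => ?_, fun i' hi' h₁' => ?_⟩
  · by_cases hi : i' = i
    · subst hi
      rw [Function.update_self]
      rcases hproc e' i' hie' hp with hp | ⟨rfl, -⟩
      · exact (h.le e' i' hie' he' hp h₁' h₂').trans h₃.le
      · exact le_rfl
    · rw [Function.update_of_ne hi]
      rcases hproc e' i' hie' hp with hp | ⟨-, hi'⟩
      · exact h.le e' i' hie' he' hp h₁' h₂'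
      · exact absurd hi' hi
  · by_cases hi : i' = i
    · subst hi
      simp only [Function.update_self]
      exact ⟨hie, he, h₁, h₂, trivial⟩
    · rw [Function.update_of_ne hi] at h₁'
      simp only [Function.update_of_ne hi]
      exact h.next i' (by omega) (by omega)

/-- The tables of the dynamic program: the layer for `m` batches is stored in `D` and `NX` at
position `a`, the layer for `m - 1` batches at position `a - (n + 1)`, and so on. -/
def Table (r p : ℕ → ℕ) (n F : ℕ) (D NX : ℕ → ℕ) : ℕ → ℕ → Prop
  -- Without further batches all jobs must be done. A bound above `F + r n` acts as infinity, since
  -- no completion time that occurs exceeds this number.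
  | 0, a => F + r n < D (a + n) ∧ ∀ i < n, D (a + i) = 0
  | m + 1, a => n + 1 ≤ a ∧
      LayerStep r p n F (fun _ _ => True) (fun i => D (a - (n + 1) + i)) (fun i => D (a + i))
        (fun i => NX (a + i)) ∧
      Table r p n F D NX m (a - (n + 1))

theorem Table.congr {D NX D' NX' : ℕ → ℕ} {m a : ℕ} (h : Table r p n F D NX m a)
    (hD : ∀ i ≤ a + n, D' i = D i) (hNX : ∀ i ≤ a + n, NX' i = NX i) :
    Table r p n F D' NX' m a := by
  induction m generalizing a with
  | zero => exact ⟨by rw [hD _ le_rfl]; exact h.1, fun i hi => by rw [hD _ (by omega), h.2 i hi]⟩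
  | succ m ih =>
    exact ⟨h.1, h.2.1.congr (fun _ _ _ _ h => h) (fun i hi => hD _ (by omega))
      (fun i hi => hD _ (by omega)) (fun i hi => hNX _ (by omega)),
      ih h.2.2 (fun i hi => hD i (by omega)) (fun i hi => hNX i (by omega))⟩

/-- Completeness of the dynamic program. The hypothesis on `C` is needed because the infinite bound
of the bottom layer is represented by a finite number; it passes to the next batch by the flow time
of the last job of the current one. -/
theorem Table.lt_of_good (hr : ∀ i j, i ≤ j → j ≤ n → r i ≤ r j) {D NX : ℕ → ℕ} {m a i C : ℕ}
    (h : Table r p n F D NX m a) (hC : C ≤ F + r n) (hg : Good r p n F m i C) :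
    C < D (a + i) := by
  induction m generalizing a i C with
  | zero =>
    obtain rfl : i = n := hg
    exact hC.trans_lt h.1
  | succ m ih =>
    obtain ⟨e, hie, hen, hre, hflow, hg⟩ := hg
    have h₁ := hflow (e - 1) (by omega) (by omega)
    rw [show e - 1 + 1 = e by omega] at h₁
    have h₂ := ih h.2.2 (h₁.trans (Nat.add_le_add_left (hr (e - 1) n (by omega) le_rfl) _)) hg
    have h₃ := lt_latest (fun i => D (a - (n + 1) + i)) hie.le hflow h₂
    have h₄ := h.2.1.le e i hie hen trivial hre (by omega)
    omega

/-- The flow times that occur in schedules without unnecessary idle time. -/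
def IsCandidate (r p : ℕ → ℕ) (n x : ℕ) : Prop :=
  ∃ a b l, a < n ∧ b ≤ l ∧ l < n ∧ x = r a + ∑ y ∈ Finset.Ico b (l + 1), p y - r l

/-- Since the last idle time, which ends at some release date `r a`, the machine has processed
consecutive jobs. So every completion time has the form occurring in `IsCandidate`, and the
constraints compare `F` with candidates only. -/
theorem Good.of_candidates {F' m i C : ℕ} (hF : ∀ x, IsCandidate r p n x → x ≤ F → x ≤ F')
    (hC : C = 0 ∨ ∃ a < n, ∃ b ≤ i, C = r a + ∑ y ∈ Finset.Ico b i, p y)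
    (h : Good r p n F m i C) : Good r p n F' m i C := by
  induction m generalizing i C with
  | zero => exact h
  | succ m ih =>
    obtain ⟨e, hie, hen, hre, hflow, hg⟩ := h
    obtain ⟨a, ha, b, hb, hab⟩ : ∃ a < n, ∃ b ≤ i,
        max C (r (e - 1)) = r a + ∑ y ∈ Finset.Ico b i, p y := by
      rcases le_total C (r (e - 1)) with h | h
      · exact ⟨e - 1, by omega, i, le_rfl, by simp [h]⟩
      · rcases hC with rfl | hC
        · exact ⟨e - 1, by omega, i, le_rfl, by simp⟩
        · rwa [max_eq_left h]
    have key : ∀ l, i ≤ l → max C (r (e - 1)) + ∑ x ∈ Finset.Ico i l, p x =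
        r a + ∑ y ∈ Finset.Ico b l, p y := by
      intro l hl
      rw [hab, add_assoc, Finset.sum_Ico_consecutive _ hb hl]
    refine ⟨e, hie, hen, hre, fun l hl hl' => ?_, ih (.inr ⟨a, ha, b, by omega, key e hie.le⟩) hg⟩
    have h₁ := hflow l hl hl'
    rw [key _ (by omega)] at h₁ ⊢
    have := hF _ ⟨a, b, l, ha, by omega, by omega, rfl⟩ (by omega)
    omega

theorem Good.exists_candidate {m : ℕ} (hn : 0 < n) (h : Good r p n F m 0 0) :
    ∃ F' ≤ F, IsCandidate r p n F' ∧ Good r p n F' m 0 0 := by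
  classical
  obtain ⟨x, hx, hxF⟩ : ∃ x, IsCandidate r p n x ∧ x ≤ F := by
    cases m with
    | zero => exact absurd (show 0 = n from h) hn.ne
    | succ m =>
      obtain ⟨e, he, hen, -, hflow, -⟩ := h
      -- The flow time of job `0`, started at `r (e - 1)`, is itself a candidate.
      have := hflow 0 le_rfl he
      rw [max_eq_right (Nat.zero_le _)] at this
      exact ⟨_, ⟨e - 1, 0, 0, by omega, le_rfl, hn, rfl⟩, by omega⟩
  exact ⟨Nat.findGreatest (IsCandidate r p n) F, Nat.findGreatest_le F,
    Nat.findGreatest_spec hxF hx,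
    h.of_candidates (fun y hy hyF => Nat.le_findGreatest hyF hy) (.inl rfl)⟩

end DynamicProgram

/-! ### Arbitrary schedules -/

/-- The machine cannot do more work than time has elapsed, so the job started last ends after all
the work. Induction adds jobs by increasing starting time. -/
theorem exists_le_completion {ι : Type} [DecidableEq ι] {S : ι → ℝ} {p : ι → ℕ} {T : Finset ι}
    (hp : ∀ y ∈ T, 0 < p y)
    (hS : ∀ y ∈ T, ∀ z ∈ T, y ≠ z → S y + p y ≤ S z ∨ S z + p z ≤ S y)
    {a : ℝ} (ha : ∀ y ∈ T, a ≤ S y) (hT : T.Nonempty) :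
    ∃ y ∈ T, a + ∑ z ∈ T, (p z : ℝ) ≤ S y + p y := by
  induction T using Finset.induction_on_max_value S with
  | empty => exact absurd hT (by simp)
  | insert y T hy hmax ih =>
    refine ⟨y, by simp, ?_⟩
    rw [Finset.sum_insert hy]
    suffices a + ∑ z ∈ T, (p z : ℝ) ≤ S y by linarith
    rcases T.eq_empty_or_nonempty with rfl | hT
    · simpa using ha
    · obtain ⟨z, hz, h⟩ := ih (fun z hz => hp z (by simp [hz]))
        (fun z hz w hw => hS z (by simp [hz]) w (by simp [hw])) (fun z hz => ha z (by simp [hz])) hT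
      rcases hS y (by simp) z (by simp [hz]) (by rintro rfl; exact hy hz) with h' | h'
      -- If `y` came first, positivity of `p y` would make `z` start later than `y`, against the
      -- maximality of `S y`.
      · have : (0 : ℝ) < p y := by exact_mod_cast hp y (by simp)
        linarith [hmax z hz]
      · exact h.trans h'

/-- Each replenishment, in order of time, becomes at most one batch, moved back to the release date
of the last job that it can serve. The hypothesis `hC` is the invariant behind the optimality: `C`
ends a block without idle time that starts at `a` with job `b`, and `S` starts none of the jobs from
`b` on before `a`. -/
theorem exists_good_of_schedule {r p : ℕ → ℕ} {n : ℕ} (hr : ∀ i j, i ≤ j → j ≤ n → r i ≤ r j)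
    (hrn : ∀ i < n, r i < r n) (hp : ∀ i < n, 0 < p i) {S : ℕ → ℝ} {f : ℝ}
    (hS : ∀ i < n, ∀ j < n, i ≠ j → S i + p i ≤ S j ∨ S j + p j ≤ S i)
    (hf : ∀ i < n, S i + p i - r i ≤ f) {Q : List ℝ} (hQ : Q.Pairwise (· < ·)) {i C : ℕ}
    (hi : i ≤ n) (hready : ∀ l, i ≤ l → l < n → ∃ t ∈ Q, (r l : ℝ) ≤ t ∧ t ≤ S l)
    (hC : ∃ a b : ℕ, b ≤ i ∧ C = a + ∑ y ∈ Finset.Ico b i, p y ∧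
      ∀ l, b ≤ l → l < n → (a : ℝ) ≤ S l) :
    ∃ m ≤ Q.length, Good r p n ⌊f⌋₊ m i C := by
  induction Q generalizing i C with
  | nil =>
    rcases hi.eq_or_lt with rfl | hi
    · exact ⟨0, le_rfl, rfl⟩
    · simpa using hready i le_rfl hi
  | cons t Q ih =>
    rw [List.pairwise_cons] at hQ
    rcases hi.eq_or_lt with rfl | hin
    · exact ⟨0, Nat.zero_le _, rfl⟩
    -- A replenishment before `r i` serves none of the remaining jobs and is dropped.
    rcases lt_or_ge t (r i) with ht | ht
    · have hready' : ∀ l, i ≤ l → l < n → ∃ t ∈ Q, (r l : ℝ) ≤ t ∧ t ≤ S l := by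
        intro l hl hln
        obtain ⟨t', ht', h₁, h₂⟩ := hready l hl hln
        rcases List.mem_cons.1 ht' with rfl | ht'
        · have : (r i : ℝ) ≤ r l := by exact_mod_cast hr i l hl hln.le
          linarith
        · exact ⟨t', ht', h₁, h₂⟩
      obtain ⟨m, hm, hg⟩ := ih hQ.2 hi hready' hC
      exact ⟨m, hm.trans (by simp), hg⟩
    classical
    -- The batch consists of all remaining jobs released by time `t`.
    have hex : ∃ e, i < e ∧ (n ≤ e ∨ t < r e) := ⟨n, hin, .inl le_rfl⟩
    obtain ⟨e, hie, he, hmin⟩ : ∃ e, i < e ∧ (n ≤ e ∨ t < r e) ∧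
        ∀ e' < e, ¬ (i < e' ∧ (n ≤ e' ∨ t < r e')) :=
      ⟨Nat.find hex, (Nat.find_spec hex).1, (Nat.find_spec hex).2, fun e' => Nat.find_min hex⟩
    have hen : e ≤ n := by
      by_contra h
      exact hmin n (by omega) ⟨hin, .inl le_rfl⟩
    have hret : (r (e - 1) : ℝ) ≤ t := by
      rcases (show i = e - 1 ∨ i < e - 1 by omega) with h | h
      · rwa [← h]
      · by_contra h'
        exact hmin (e - 1) (by omega) ⟨h, .inr (not_le.1 h')⟩
    have hre : r (e - 1) < r e := by
      rcases he with he | he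
      · obtain rfl : e = n := by omega
        exact hrn _ (by omega)
      · exact_mod_cast hret.trans_lt he
    have htS : ∀ l, i ≤ l → l < n → t ≤ S l := by
      intro l hl hln
      obtain ⟨t', ht', h₁, h₂⟩ := hready l hl hln
      rcases List.mem_cons.1 ht' with rfl | ht'
      · exact h₂
      · exact (hQ.1 t' ht').le.trans h₂
    obtain ⟨a, b, hb, hab, ha⟩ : ∃ a b : ℕ, b ≤ i ∧
        max C (r (e - 1)) = a + ∑ y ∈ Finset.Ico b i, p y ∧
        ∀ l, b ≤ l → l < n → (a : ℝ) ≤ S l := by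
      -- Waiting for the replenishment opens a new block; otherwise the current block continues.
      rcases le_total C (r (e - 1)) with h | h
      · exact ⟨r (e - 1), i, le_rfl, by simp [h], fun l hl hln => hret.trans (htS l hl hln)⟩
      · rwa [max_eq_left h]
    have key : ∀ l, i ≤ l → max C (r (e - 1)) + ∑ x ∈ Finset.Ico i l, p x =
        a + ∑ y ∈ Finset.Ico b l, p y := by
      intro l hl
      rw [hab, add_assoc, Finset.sum_Ico_consecutive _ hb hl]
    have hready' : ∀ l, e ≤ l → l < n → ∃ t ∈ Q, (r l : ℝ) ≤ t ∧ t ≤ S l := by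
      intro l hl hln
      obtain ⟨t', ht', h₁, h₂⟩ := hready l (by omega) hln
      rcases List.mem_cons.1 ht' with rfl | ht'
      · rcases he with he | he
        · omega
        · have : (r e : ℝ) ≤ r l := by exact_mod_cast hr e l hl hln.le
          linarith
      · exact ⟨t', ht', h₁, h₂⟩
    obtain ⟨m, hm, hg⟩ := ih hQ.2 hen (C := max C (r (e - 1)) + ∑ x ∈ Finset.Ico i e, p x)
      hready' ⟨a, b, by omega, key e hie.le, ha⟩
    refine ⟨m + 1, by simpa using hm, e, hie, hen, hre, fun l hl hle => ?_, hg⟩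
    rw [key _ (by omega)]
    -- Some job `y` of the block ends in `S` no earlier than job `l` does in the batch schedule; as
    -- `r y ≤ r l`, its flow time bounds that of `l`.
    obtain ⟨y, hy, h⟩ := exists_le_completion (S := S) (p := p) (T := Finset.Ico b (l + 1))
      (a := a) (fun y hy => hp y (by simp at hy; omega))
      (fun y hy z hz => hS y (by simp at hy; omega) z (by simp at hz; omega))
      (fun y hy => ha y (by simp at hy; omega) (by simp at hy; omega)) ⟨b, by simp; omega⟩
    rw [Finset.mem_Ico] at hy
    have h₁ := hf y (by omega)
    have h₂ : (r y : ℝ) ≤ r l := by exact_mod_cast hr y l (by omega) (by omega)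
    rw [← Nat.sub_le_iff_le_add]
    apply Nat.le_floor
    -- When the truncated difference vanishes, what remains is that `f` is nonnegative, which the
    -- flow time of `l` in `S` shows.
    rcases le_total (a + ∑ y ∈ Finset.Ico b (l + 1), p y) (r l) with h₃ | h₃
    · rw [Nat.sub_eq_zero_of_le h₃, Nat.cast_zero]
      have : (0 : ℝ) ≤ p l := Nat.cast_nonneg _
      have h₄ : (r l : ℝ) ≤ S l := by
        obtain ⟨t', _, h₅, h₆⟩ := hready l hl (by omega)
        exact h₅.trans h₆
      linarith [hf l (by omega)]
    · rw [Nat.cast_sub h₃]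
      push_cast
      linarith

end JRP
namespace RAM

/-! ### Reasoning about commands -/

section Frame

variable {α β : Type}

instance : Add (Expr α β) := ⟨.add⟩
instance : Sub (Expr α β) := ⟨.sub⟩
instance (v : ℕ) : OfNat (Expr α β) v := ⟨.const v⟩

@[simp] theorem Expr.eval_size (n : ℕ) (σ : Store α β) : (size : Expr α β).eval n σ = n := rfl
@[simp] theorem Expr.eval_var (n : ℕ) (σ : Store α β) (x : α) : (var x).eval n σ = σ.var x := rfl
@[simp] theorem Expr.eval_get (n : ℕ) (σ : Store α β) (t : β) (a : Expr α β) :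
    (get t a).eval n σ = σ.arr t (a.eval n σ) := rfl
@[simp] theorem Expr.eval_add (n : ℕ) (σ : Store α β) (a b : Expr α β) :
    (a + b).eval n σ = a.eval n σ + b.eval n σ := rfl
@[simp] theorem Expr.eval_sub (n : ℕ) (σ : Store α β) (a b : Expr α β) :
    (a - b).eval n σ = a.eval n σ - b.eval n σ := rfl
@[simp] theorem Expr.eval_zero (n : ℕ) (σ : Store α β) : (0 : Expr α β).eval n σ = 0 := rfl
@[simp] theorem Expr.eval_one (n : ℕ) (σ : Store α β) : (1 : Expr α β).eval n σ = 1 := rfl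

@[simp] theorem Store.setVar_var [DecidableEq α] (σ : Store α β) (x y : α) (v : ℕ) :
    (σ.setVar x v).var y = if y = x then v else σ.var y := Function.update_apply ..
@[simp] theorem Store.setVar_arr [DecidableEq α] (σ : Store α β) (x : α) (v : ℕ) :
    (σ.setVar x v).arr = σ.arr := rfl
@[simp] theorem Store.setVar_input [DecidableEq α] (σ : Store α β) (x : α) (v : ℕ) :
    (σ.setVar x v).input = σ.input := rfl
@[simp] theorem Store.setVar_output [DecidableEq α] (σ : Store α β) (x : α) (v : ℕ) :
    (σ.setVar x v).output = σ.output := rfl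
@[simp] theorem Store.setArr_arr [DecidableEq β] (σ : Store α β) (t u : β) (i v : ℕ) :
    (σ.setArr t i v).arr u = if u = t then Function.update (σ.arr t) i v else σ.arr u :=
  Function.update_apply ..
@[simp] theorem Store.setArr_var [DecidableEq β] (σ : Store α β) (t : β) (i v : ℕ) :
    (σ.setArr t i v).var = σ.var := rfl
@[simp] theorem Store.setArr_input [DecidableEq β] (σ : Store α β) (t : β) (i v : ℕ) :
    (σ.setArr t i v).input = σ.input := rfl

/-- The commands of a list, one after the other. -/
def Cmd.block : List (Cmd α β) → Cmd α β
  | [] => skip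
  | c :: L => seq c (block L)

variable [DecidableEq α] [DecidableEq β]

@[simp] theorem Cmd.eval_block_nil (n : ℕ) (σ : Store α β) : (block []).eval n σ = σ := rfl
@[simp] theorem Cmd.eval_block_cons (n : ℕ) (c : Cmd α β) (L : List (Cmd α β)) (σ : Store α β) :
    (block (c :: L)).eval n σ = (block L).eval n (c.eval n σ) := rfl
@[simp] theorem Cmd.eval_skip (n : ℕ) (σ : Store α β) : (skip : Cmd α β).eval n σ = σ := rfl
@[simp] theorem Cmd.eval_set (n : ℕ) (x : α) (a : Expr α β) (σ : Store α β) :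
    (set x a).eval n σ = σ.setVar x (a.eval n σ) := rfl
@[simp] theorem Cmd.eval_put (n : ℕ) (t : β) (a b : Expr α β) (σ : Store α β) :
    (put t a b).eval n σ = σ.setArr t (a.eval n σ) (b.eval n σ) := rfl
@[simp] theorem Cmd.eval_read (n : ℕ) (x : α) (σ : Store α β) :
    (read x).eval n σ = { σ.setVar x (σ.input.headD 0) with input := σ.input.tail } := rfl
@[simp] theorem Cmd.eval_write (n : ℕ) (a : Expr α β) (σ : Store α β) :
    (write a).eval n σ = { σ with output := σ.output ++ [a.eval n σ] } := rfl
@[simp] theorem Cmd.eval_ite (n : ℕ) (a : Expr α β) (c d : Cmd α β) (σ : Store α β) :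
    (ite a c d).eval n σ = if a.eval n σ = 0 then d.eval n σ else c.eval n σ := rfl

/-- Whether a command may change a variable. -/
def Cmd.writesVar (y : α) : Cmd α β → Bool
  | set x _ => y = x
  | read x => y = x
  | seq c d => c.writesVar y || d.writesVar y
  | ite _ c d => c.writesVar y || d.writesVar y
  | loop x c => y = x || c.writesVar y
  | _ => false

/-- Whether a command may change an array. -/
def Cmd.writesArr (u : β) : Cmd α β → Bool
  | put t _ _ => u = t
  | seq c d => c.writesArr u || d.writesArr u
  | ite _ c d => c.writesArr u || d.writesArr u
  | loop _ c => c.writesArr u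
  | _ => false

/-- Whether a command may change the output. -/
def Cmd.writesOutput : Cmd α β → Bool
  | write _ => true
  | seq c d => c.writesOutput || d.writesOutput
  | ite _ c d => c.writesOutput || d.writesOutput
  | loop _ c => c.writesOutput
  | _ => false

/-- The stores `σ` and `τ` agree on all that the command `c` cannot change. -/
structure Cmd.Frame (c : Cmd α β) (σ τ : Store α β) : Prop where
  var : ∀ y, c.writesVar y = false → τ.var y = σ.var y
  arr : ∀ u, c.writesArr u = false → τ.arr u = σ.arr u
  output : c.writesOutput = false → τ.output = σ.output

theorem Cmd.Frame.refl (c : Cmd α β) (σ : Store α β) : c.Frame σ σ :=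
  ⟨fun _ _ => rfl, fun _ _ => rfl, fun _ => rfl⟩

theorem Cmd.Frame.trans {c : Cmd α β} {σ τ υ : Store α β} (h : c.Frame σ τ) (h' : c.Frame τ υ) :
    c.Frame σ υ :=
  ⟨fun y hy => (h'.var y hy).trans (h.var y hy), fun u hu => (h'.arr u hu).trans (h.arr u hu),
    fun ho => (h'.output ho).trans (h.output ho)⟩

/-- What a command may write is computed from its syntax, so in the proofs about concrete programs
each fact that something is unchanged has its side condition closed by `rfl`. -/
theorem Cmd.frame (n : ℕ) (c : Cmd α β) : ∀ σ, c.Frame σ (c.eval n σ) := by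
  induction c with
  | skip => exact fun σ => .refl _ _
  | set x a => exact fun σ => ⟨fun y hy => by simp_all [writesVar], fun _ _ => rfl, fun _ => rfl⟩
  | put t a b => exact fun σ => ⟨fun _ _ => rfl, fun u hu => by simp_all [writesArr], fun _ => rfl⟩
  | read x => exact fun σ => ⟨fun y hy => by simp_all [writesVar], fun _ _ => rfl, fun _ => rfl⟩
  | write a => exact fun σ => ⟨fun _ _ => rfl, fun _ _ => rfl, fun h => by simp [writesOutput] at h⟩
  | seq c d ihc ihd =>
    refine fun σ => ⟨fun y hy => ?_, fun u hu => ?_, fun ho => ?_⟩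
    · simp only [writesVar, Bool.or_eq_false_iff] at hy
      exact ((ihd _).var y hy.2).trans ((ihc σ).var y hy.1)
    · simp only [writesArr, Bool.or_eq_false_iff] at hu
      exact ((ihd _).arr u hu.2).trans ((ihc σ).arr u hu.1)
    · simp only [writesOutput, Bool.or_eq_false_iff] at ho
      exact ((ihd _).output ho.2).trans ((ihc σ).output ho.1)
  | ite a c d ihc ihd =>
    refine fun σ => ⟨fun y hy => ?_, fun u hu => ?_, fun ho => ?_⟩
    · simp only [writesVar, Bool.or_eq_false_iff] at hy
      simp only [eval_ite]
      split_ifs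
      exacts [(ihd _).var y hy.2, (ihc _).var y hy.1]
    · simp only [writesArr, Bool.or_eq_false_iff] at hu
      simp only [eval_ite]
      split_ifs
      exacts [(ihd _).arr u hu.2, (ihc _).arr u hu.1]
    · simp only [writesOutput, Bool.or_eq_false_iff] at ho
      simp only [eval_ite]
      split_ifs
      exacts [(ihd _).output ho.2, (ihc _).output ho.1]
  | loop x c ih =>
    refine fun σ => forRange_induction (P := fun _ τ => (loop x c).Frame σ τ) (.refl _ _)
      fun i τ _ hτ => hτ.trans ⟨fun y hy => ?_, fun u hu => ?_, fun ho => ?_⟩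
    · simp only [writesVar, Bool.or_eq_false_iff, decide_eq_false_iff_not] at hy
      rw [(ih _).var y hy.2, Store.setVar_var, if_neg hy.1]
    · exact (ih _).arr u hu
    · exact (ih _).output ho

/-- The rule for loops: an invariant, together with the frame of the loop. -/
theorem Cmd.loop_induction {n : ℕ} {x : α} {c : Cmd α β} {σ : Store α β}
    (P : ℕ → Store α β → Prop) (zero : P 0 σ)
    (succ : ∀ i τ, i < n → (loop x c).Frame σ τ → P i τ → P (i + 1) (c.eval n (τ.setVar x i))) :
    P n ((loop x c).eval n σ) := by
  refine (forRange_induction (P := fun i τ => (loop x c).Frame σ τ ∧ P i τ) ⟨.refl _ _, zero⟩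
    fun i τ hi h => ⟨h.1.trans ⟨fun y hy => ?_, fun u hu => ?_, fun ho => ?_⟩,
      succ i τ hi h.1 h.2⟩).2
  · simp only [writesVar, Bool.or_eq_false_iff, decide_eq_false_iff_not] at hy
    rw [(c.frame n _).var y hy.2, Store.setVar_var, if_neg hy.1]
  · exact (c.frame n _).arr u hu
  · exact (c.frame n _).output ho

end Frame

end RAM

namespace JRP

open RAM

/-! ### The program -/

/-- The variables of the program. -/
inductive Var
  | K | T | t | j | l | rk | a | b | acc | F | base | val | best | m | k | x | i | h | e | C | lb
  | cnt
  deriving DecidableEq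

/-- The arrays of the program. -/
inductive Arr
  | R | P | RK | SR | SP | D | NX | S | Q
  deriving DecidableEq

theorem Var.ctorIdx_injective : Function.Injective Var.ctorIdx :=
  Function.LeftInverse.injective (g := Var.ofNat) Var.ofNat_ctorIdx

theorem Arr.exists_injective : ∃ g : Arr → Fin 16, g.Injective :=
  ⟨fun t => ⟨t.ctorIdx, by cases t <;> decide⟩,
    fun t u h => Function.LeftInverse.injective (g := Arr.ofNat) Arr.ofNat_ctorIdx (Fin.mk.inj h)⟩

abbrev State := Store Var Arr

/-- A variable as an expression. -/
abbrev v (y : Var) : Expr Var Arr := .var y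

/-- Take the batch of the jobs `k - i, …, k` into account. -/
def relaxStep : Cmd Var Arr :=
  -- Loops always run over the whole range; the test, nonzero iff `i ≤ k`, disables the superfluous
  -- rounds.
  .ite (v .k + 1 - v .i)
    (.block [
      .set .t (v .k - v .i),
      -- Here `x - (x - y)` is the minimum of `x` and `y`, so this is one step of the recursion of
      -- `latest`.
      .set .x (v .x - (v .x - (v .F + .get .SR (v .t) + 1)) - .get .SP (v .t)),
      .ite (v .x - .get .SR (v .k))
        (.ite (v .x - .get .D (v .base + v .t))
          (.block [.put .D (v .base + v .t) (v .x), .put .NX (v .base + v .t) (v .k + 1)])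
          .skip)
        .skip])
    .skip

/-- Take all batches that end with the job `k` into account. -/
def relax : Cmd Var Arr :=
  .ite (.get .SR (v .k + 1) - .get .SR (v .k))
    (.block [.set .x (.get .D (v .base - (.size + 1) + (v .k + 1))), .loop .i relaxStep])
    .skip

/-- Compute the layer of the dynamic program at position `base`. -/
def layer : Cmd Var Arr := .loop .k relax

/-- Schedule the job `h` at time `C`, or start a new batch with it. -/
def extractStep : Cmd Var Arr :=
  .block [
    .ite (v .e - v .h) .skip
      (.block [
        .set .e (.get .NX (v .lb + v .h)),
        .set .lb (v .lb - (.size + 1)),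
        .set .t (.get .SR (v .e - 1)),
        -- The maximum of `C` and `t`.
        .set .C (v .C + (v .t - v .C)),
        .put .Q (v .cnt) (v .t),
        .set .cnt (v .cnt + 1)]),
    .put .S (v .h) (v .C),
    .set .C (v .C + .get .SP (v .h))]

/-- Extract a schedule from the tables of the dynamic program. -/
def extract : Cmd Var Arr :=
  .block [.set .cnt 0, .set .e 0, .set .C 0, .set .lb (v .base), .loop .h extractStep]

/-- Compute the next layer, and record the schedule if it is the best one up to now. -/
def layerStep : Cmd Var Arr :=
  .block [
    .set .base (v .base + (.size + 1)),
    .set .val (v .val + v .K),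
    layer,
    .ite (.get .D (v .base))
      -- Nonzero iff `val < best` or `best = 0`. Both values are one more than a cost, so that `0`
      -- can mean that nothing has been recorded.
      (.ite (v .best - v .val + (1 - v .best)) (.block [.set .best (v .val), extract]) .skip)
      .skip]

/-- Look for the best schedule with flow times at most `F`. -/
def tryBound : Cmd Var Arr :=
  .block [
    .put .D (v .base + .size) (v .F + .get .SR .size + 1),
    .set .val (v .F + 1),
    .loop .m layerStep,
    -- Each bound works in new memory, still zero, so tables are never cleared.
    .set .base (v .base + (.size + 1))]

def candidateStep : Cmd Var Arr :=
  .ite (v .l + 1 - v .b)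
    (.block [.set .acc (v .acc + .get .SP (v .l)), .set .F (v .acc - .get .SR (v .l)), tryBound])
    .skip

/-- Try all candidates for the maximum flow time. -/
def search : Cmd Var Arr :=
  .loop .a (.loop .b (.block [.set .acc (.get .SR (v .a)), .loop .l candidateStep]))

/-- Read a job. -/
def readStep : Cmd Var Arr :=
  .block [
    .read .t,
    .put .R (v .j) (v .t),
    -- `T` stays above all release dates read so far and becomes the sentinel.
    .set .T (v .T + (v .t + 1 - v .T)),
    .read .t,
    .put .P (v .j) (v .t),
    .read .t]

def readInput : Cmd Var Arr :=
  .block [.read .K, .read .t, .set .K (v .K + v .t), .loop .j readStep]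

/-- Count the job `l` if it precedes the job `j`. -/
def rankStep : Cmd Var Arr :=
  -- The nested subtraction is `1` if `l < j` and `0` otherwise; it breaks ties by job number.
  .ite (.get .R (v .j) + (1 - (1 - (v .j - v .l))) - .get .R (v .l)) (.set .rk (v .rk + 1)) .skip

/-- Put the job `j` in its place. -/
def sortStep : Cmd Var Arr :=
  .block [
    .set .rk 0,
    .loop .l rankStep,
    .put .RK (v .j) (v .rk),
    .put .SR (v .rk) (.get .R (v .j)),
    .put .SP (v .rk) (.get .P (v .j))]

def sort : Cmd Var Arr := .block [.loop .j sortStep, .put .SR .size (v .T)]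

def writeReplStep : Cmd Var Arr :=
  .ite (v .cnt - v .j) (.block [.write (.get .Q (v .j)), .write 1]) .skip

def writeStartStep : Cmd Var Arr := .write (.get .S (.get .RK (v .j)))

def writeOutput : Cmd Var Arr :=
  .block [.write (v .cnt), .loop .j writeReplStep, .loop .j writeStartStep]

def program : Cmd Var Arr := .block [readInput, sort, search, writeOutput]

/-! ### Correctness of the dynamic program -/

/-- The layer at position `base` of the store `σ` has partly been computed, with result `s`. -/
structure LayerInv (n : ℕ) (σ s : State) (proc : ℕ → ℕ → Prop) : Prop where
  step : LayerStep (σ.arr .SR) (σ.arr .SP) n (σ.var .F) proc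
    (fun i => σ.arr .D (σ.var .base - (n + 1) + i)) (fun i => s.arr .D (σ.var .base + i))
    (fun i => s.arr .NX (σ.var .base + i))
  agree : ∀ a, a < σ.var .base ∨ σ.var .base + n < a →
    s.arr .D a = σ.arr .D a ∧ s.arr .NX a = σ.arr .NX a

theorem update_add_left (D : ℕ → ℕ) (b i x : ℕ) :
    (fun j => Function.update D (b + i) x (b + j)) =
      Function.update (fun j => D (b + j)) i x := by
  funext j
  simp [Function.update_apply]

/-- The batches ending with job `k` are treated by decreasing first job, so that `x` can be updated
by the recursion of `latest`. Its value is claimed only for `i ≤ k + 1`, as later rounds do nothing.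
-/
theorem relaxLoop_spec {n : ℕ} {σ s : State} {k : ℕ} (hk : k < n) (hsk : s.var .k = k)
    (hbase : s.var .base = σ.var .base) (hF : s.var .F = σ.var .F)
    (hSR : s.arr .SR = σ.arr .SR) (hSP : s.arr .SP = σ.arr .SP)
    (hlt : σ.arr .SR k < σ.arr .SR (k + 1))
    (hx : s.var .x = σ.arr .D (σ.var .base - (n + 1) + (k + 1)))
    (h : LayerInv n σ s fun e _ => e ≤ k) :
    LayerInv n σ ((Cmd.loop .i relaxStep).eval n s) fun e _ => e ≤ k + 1 := by
  have main := Cmd.loop_induction (n := n) (x := .i) (c := relaxStep) (σ := s)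
    (fun i τ => (i ≤ k + 1 → τ.var .x =
        latest (σ.arr .SR) (σ.arr .SP) (σ.var .F)
          (fun i => σ.arr .D (σ.var .base - (n + 1) + i)) (k + 1) (k + 1 - i)) ∧
      LayerInv n σ τ fun e j => e ≤ k ∨ e = k + 1 ∧ k + 1 - i ≤ j) ?_ ?_
  · exact ⟨main.2.step.congr (fun e i h₁ h₂ h₃ => by omega) (fun _ _ => rfl) (fun _ _ => rfl)
      (fun _ _ => rfl), main.2.agree⟩
  · refine ⟨fun _ => by simp [latest_self, hx], ?_, h.agree⟩
    exact h.step.congr (fun e i h₁ h₂ h₃ => by omega) (fun _ _ => rfl) (fun _ _ => rfl)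
      (fun _ _ => rfl)
  · rintro i τ hi hτ ⟨hx, hinv⟩
    have e₁ : τ.var .k = k := (hτ.var .k rfl).trans hsk
    have e₂ : τ.var .base = σ.var .base := (hτ.var .base rfl).trans hbase
    have e₃ : τ.var .F = σ.var .F := (hτ.var .F rfl).trans hF
    have e₄ : τ.arr .SR = σ.arr .SR := (hτ.arr .SR rfl).trans hSR
    have e₅ : τ.arr .SP = σ.arr .SP := (hτ.arr .SP rfl).trans hSP
    by_cases hik : i ≤ k
    · have hx := hx (by omega)
      have hl := latest_of_lt (r := σ.arr .SR) (p := σ.arr .SP) (F := σ.var .F)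
        (fun i => σ.arr .D (σ.var .base - (n + 1) + i))
        (show k - i < k + 1 by omega)
      rw [show k - i + 1 = k + 1 - i by omega, ← hx] at hl
      have hmin : τ.var .x - (τ.var .x - (σ.var .F + σ.arr .SR (k - i) + 1)) -
          σ.arr .SP (k - i) = latest (σ.arr .SR) (σ.arr .SP) (σ.var .F)
          (fun i => σ.arr .D (σ.var .base - (n + 1) + i)) (k + 1) (k - i) := by
        omega
      have hne : ¬ (k + 1 - i = 0) := by omega
      set X := latest (σ.arr .SR) (σ.arr .SP) (σ.var .F)
          (fun i => σ.arr .D (σ.var .base - (n + 1) + i)) (k + 1) (k - i) with hX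
      simp only [relaxStep, Cmd.eval_ite, Cmd.eval_block_cons, Cmd.eval_block_nil, Cmd.eval_set,
        Cmd.eval_put, Cmd.eval_skip, Expr.eval_add, Expr.eval_sub, Expr.eval_var, Expr.eval_get,
        Expr.eval_one, Store.setVar_var, Store.setVar_arr, Store.setArr_var, reduceCtorEq,
        if_true, if_false, e₁, e₂, e₃, e₄, e₅, hmin, hne]
      have hproc : ∀ e' i', i' < e' → (e' ≤ k ∨ e' = k + 1 ∧ k + 1 - (i + 1) ≤ i') →
          (e' ≤ k ∨ e' = k + 1 ∧ k + 1 - i ≤ i') ∨ e' = k + 1 ∧ i' = k - i := by omega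
      have hx' : ∀ τ' : State, τ'.var .x = X → i + 1 ≤ k + 1 →
          τ'.var .x = latest (σ.arr .SR) (σ.arr .SP) (σ.var .F)
          (fun i => σ.arr .D (σ.var .base - (n + 1) + i)) (k + 1) (k + 1 - (i + 1)) := by
        intro τ' h _
        rw [h, hX, Nat.add_sub_add_right]
      split_ifs with h₁ h₂
      · refine ⟨hx' _ (by simp), ?_, by simpa using hinv.agree⟩
        exact hinv.step.skip hproc fun _ h => by simp at h; omega
      · refine ⟨hx' _ (by simp), ?_, by simpa using hinv.agree⟩
        exact hinv.step.skip hproc fun _ h => by omega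
      · refine ⟨hx' _ (by simp), ?_, fun a ha => ?_⟩
        · have := hinv.step.update hproc (by omega) (by omega) hlt
            (show σ.arr .SR (k + 1 - 1) < X by simp; omega) (show _ < X by omega)
          rw [← update_add_left, ← update_add_left] at this
          simpa [e₂] using this
        · have : a ≠ σ.var .base + (k - i) := by omega
          simpa [this, e₂] using hinv.agree a ha
    · have hne : k + 1 - i = 0 := by omega
      simp only [relaxStep, Cmd.eval_ite, Cmd.eval_skip, Expr.eval_add, Expr.eval_sub,
        Expr.eval_var, Expr.eval_one, Store.setVar_var, reduceCtorEq, if_true, if_false, e₁, hne]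
      refine ⟨fun h => by omega, ?_, hinv.agree⟩
      exact hinv.step.congr (fun e i h₁ h₂ h₃ => by omega) (fun _ _ => rfl) (fun _ _ => rfl)
        (fun _ _ => rfl)

theorem layer_spec {n : ℕ} {σ : State} (hbase : n + 1 ≤ σ.var .base)
    (h0 : ∀ i ≤ n, σ.arr .D (σ.var .base + i) = 0) :
    LayerInv n σ (layer.eval n σ) fun _ _ => True := by
  have main := Cmd.loop_induction (n := n) (x := .k) (c := relax) (σ := σ)
    (fun k τ => LayerInv n σ τ fun e _ => e ≤ k) ?_ ?_
  · exact ⟨main.step.congr (fun e i h₁ h₂ h₃ => by omega) (fun _ _ => rfl) (fun _ _ => rfl)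
      (fun _ _ => rfl), main.agree⟩
  · exact ⟨⟨fun e i h₁ h₂ h₃ => by omega, fun i hi h => absurd (h0 i hi) h.ne'⟩,
      fun a _ => ⟨rfl, rfl⟩⟩
  · intro k τ hk hτ hinv
    have e₂ : τ.var .base = σ.var .base := hτ.var .base rfl
    have e₃ : τ.var .F = σ.var .F := hτ.var .F rfl
    have e₄ : τ.arr .SR = σ.arr .SR := hτ.arr .SR rfl
    have e₅ : τ.arr .SP = σ.arr .SP := hτ.arr .SP rfl
    by_cases hlt : σ.arr .SR k < σ.arr .SR (k + 1)
    · have hne : ¬ (σ.arr .SR (k + 1) - σ.arr .SR k = 0) := by omega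
      simp only [relax, Cmd.eval_ite, Cmd.eval_block_cons, Cmd.eval_block_nil, Cmd.eval_set,
        Expr.eval_add, Expr.eval_sub, Expr.eval_var, Expr.eval_get, Expr.eval_size,
        Expr.eval_one, Store.setVar_var, Store.setVar_arr, reduceCtorEq, if_true, if_false,
        e₂, e₄, hne]
      refine relaxLoop_spec hk (by simp) (by simp [e₂]) (by simp [e₃]) e₄ e₅ hlt ?_
        ⟨hinv.step, hinv.agree⟩
      simp [(hinv.agree (σ.var .base - (n + 1) + (k + 1)) (by omega)).1]
    · have hne : σ.arr .SR (k + 1) - σ.arr .SR k = 0 := by omega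
      simp only [relax, Cmd.eval_ite, Cmd.eval_skip, Expr.eval_add, Expr.eval_sub,
        Expr.eval_var, Expr.eval_get, Expr.eval_one, Store.setVar_var, Store.setVar_arr,
        if_true, e₄, hne]
      refine ⟨⟨fun e i h₁ h₂ h₃ h₄ h₅ => ?_, hinv.step.next⟩, hinv.agree⟩
      rcases Nat.lt_or_ge k e with h | h
      · obtain rfl : e = k + 1 := by omega
        exact absurd h₄ hlt
      · exact hinv.step.le e i h₁ h₂ h h₄ h₅

end JRP
namespace JRP

open RAM

/-! ### Extracting a schedule from the tables -/

/-- A schedule with flow times at most `F` and with `cnt ≤ m` replenishments; the job `l` is started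
at time `S l`, and the replenishments are at times `Q 0, …, Q (cnt - 1)`. -/
structure IsSchedule (r p : ℕ → ℕ) (n F m : ℕ) (S Q : ℕ → ℕ) (cnt : ℕ) : Prop where
  cnt_le : cnt ≤ m
  flow : ∀ l < n, S l + p l ≤ F + r l
  disjoint : ∀ l l', l < l' → l' < n → S l + p l ≤ S l'
  ready : ∀ l < n, ∃ c < cnt, r l ≤ Q c ∧ Q c ≤ S l
  increasing : ∀ c d, c < d → d < cnt → Q c < Q d

/-- The jobs before `h` have been scheduled, and the current batch ends with the job `e - 1`. -/
structure PartialSchedule (r p : ℕ → ℕ) (n F : ℕ) (D NX : ℕ → ℕ) (m h e C lb : ℕ) (S Q : ℕ → ℕ)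
    (cnt : ℕ) : Prop where
  le : h ≤ e
  le_n : e ≤ n
  table : ∃ m', Table r p n F D NX m' lb ∧ cnt + m' = m
  lt : C < latest r p F (fun i => D (lb + i)) e h
  completed : ∀ l < h, S l + p l ≤ C
  current : h < e → ∃ c < cnt, Q c = r (e - 1) ∧ r (e - 1) ≤ C
  last : ∀ c < cnt, Q c < r e
  flow : ∀ l < h, S l + p l ≤ F + r l
  disjoint : ∀ l l', l < l' → l' < h → S l + p l ≤ S l'
  ready : ∀ l < h, ∃ c < cnt, r l ≤ Q c ∧ Q c ≤ S l
  increasing : ∀ c c', c < c' → c' < cnt → Q c < Q c'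

section PartialSchedule

variable {r p : ℕ → ℕ} {n F : ℕ} {D NX : ℕ → ℕ} {m h e C lb : ℕ} {S Q : ℕ → ℕ} {cnt : ℕ}

theorem PartialSchedule.newBatch (hr : ∀ i j, i ≤ j → j ≤ n → r i ≤ r j)
    (H : PartialSchedule r p n F D NX m h h C lb S Q cnt) (hn : h < n) :
    PartialSchedule r p n F D NX m h (NX (lb + h)) (C + (r (NX (lb + h) - 1) - C)) (lb - (n + 1)) S
      (Function.update Q cnt (r (NX (lb + h) - 1))) (cnt + 1) ∧ h < NX (lb + h) := by
  obtain ⟨m', hT, hm'⟩ := H.table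
  have hlt := H.lt
  rw [latest_self] at hlt
  cases m' with
  -- The bottom layer has bound `0` at every unfinished job, and no time lies below it.
  | zero => exact absurd (hT.2 h hn) (by omega)
  | succ m' =>
    obtain ⟨-, hL, hT⟩ := hT
    obtain ⟨h₁, h₂, h₃, h₄, h₅⟩ := hL.next h hn.le (by omega)
    set e' := NX (lb + h)
    have hQ : ∀ c < cnt, Function.update Q cnt (r (e' - 1)) c = Q c :=
      fun c hc => Function.update_of_ne hc.ne _ _
    refine ⟨⟨h₁.le, h₂, ⟨m', hT, by omega⟩, by omega, fun l hl => ?_, fun _ => ?_,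
      fun c hc => ?_, H.flow, H.disjoint, fun l hl => ?_, fun c c' hc hc' => ?_⟩, h₁⟩
    · have := H.completed l hl
      omega
    · exact ⟨cnt, by omega, by simp, by omega⟩
    · rcases (show c < cnt ∨ c = cnt by omega) with hc | rfl
      · rw [hQ c hc]
        exact (H.last c hc).trans_le (hr h e' h₁.le h₂)
      · simpa using h₃
    · obtain ⟨c, hc, h⟩ := H.ready l hl
      exact ⟨c, by omega, by rwa [hQ c hc]⟩
    · rw [hQ c (by omega)]
      rcases (show c' < cnt ∨ c' = cnt by omega) with hc' | rfl
      · rw [hQ c' hc']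
        exact H.increasing c c' hc hc'
      · rw [Function.update_self]
        -- Earlier replenishments precede `r h`, the release date of the first job of the new batch.
        exact (H.last c hc).trans_le (hr h (e' - 1) (by omega) (by omega))

theorem PartialSchedule.next (hr : ∀ i j, i ≤ j → j ≤ n → r i ≤ r j)
    (H : PartialSchedule r p n F D NX m h e C lb S Q cnt) (he : h < e) :
    PartialSchedule r p n F D NX m (h + 1) e (C + p h) lb (Function.update S h C) Q cnt := by
  have hlt := H.lt
  rw [latest_of_lt _ he] at hlt
  have hS : ∀ l < h, Function.update S h C l = S l := fun l hl => Function.update_of_ne hl.ne _ _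
  obtain ⟨c₀, hc₀, hQ, hC⟩ := H.current he
  refine ⟨he, H.le_n, H.table, by omega, fun l hl => ?_, fun _ => ⟨c₀, hc₀, hQ, by omega⟩, H.last,
    fun l hl => ?_, fun l l' hl hl' => ?_, fun l hl => ?_, H.increasing⟩
  · rcases (show l < h ∨ l = h by omega) with hl | rfl
    · rw [hS l hl]
      exact (H.completed l hl).trans (by omega)
    · simp
  · rcases (show l < h ∨ l = h by omega) with hl | rfl
    · rw [hS l hl]
      exact H.flow l hl
    · rw [Function.update_self]
      omega
  · rw [hS l (by omega)]
    rcases (show l' < h ∨ l' = h by omega) with hl' | rfl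
    · rw [hS l' hl']
      exact H.disjoint l l' hl hl'
    · rw [Function.update_self]
      exact H.completed l hl
  · rcases (show l < h ∨ l = h by omega) with hl | rfl
    · rw [hS l hl]
      exact H.ready l hl
    · rw [Function.update_self]
      refine ⟨c₀, hc₀, ?_, by omega⟩
      rw [hQ]
      exact hr l (e - 1) (by omega) (by have := H.le_n; omega)

end PartialSchedule

/-- Soundness of the dynamic program: a positive bound at job `0` admits the starting time `0`, and
following the recorded batch ends keeps the time below every later bound. -/
theorem extract_spec {n m : ℕ} {σ : State}
    (hr : ∀ i j, i ≤ j → j ≤ n → σ.arr .SR i ≤ σ.arr .SR j)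
    (hT : Table (σ.arr .SR) (σ.arr .SP) n (σ.var .F) (σ.arr .D) (σ.arr .NX) m (σ.var .base))
    (hpos : 0 < σ.arr .D (σ.var .base)) :
    IsSchedule (σ.arr .SR) (σ.arr .SP) n (σ.var .F) m ((extract.eval n σ).arr .S)
      ((extract.eval n σ).arr .Q) ((extract.eval n σ).var .cnt) := by
  set s : State := (((σ.setVar .cnt 0).setVar .e 0).setVar .C 0).setVar .lb (σ.var .base) with hs
  have hext : extract.eval n σ = (Cmd.loop .h extractStep).eval n s := rfl
  rw [hext]
  suffices H : PartialSchedule (σ.arr .SR) (σ.arr .SP) n (σ.var .F) (σ.arr .D) (σ.arr .NX) m n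
      (((Cmd.loop .h extractStep).eval n s).var .e) (((Cmd.loop .h extractStep).eval n s).var .C)
      (((Cmd.loop .h extractStep).eval n s).var .lb) (((Cmd.loop .h extractStep).eval n s).arr .S)
      (((Cmd.loop .h extractStep).eval n s).arr .Q)
      (((Cmd.loop .h extractStep).eval n s).var .cnt) by
    obtain ⟨m', -, hm'⟩ := H.table
    exact ⟨by omega, H.flow, H.disjoint, H.ready, H.increasing⟩
  refine Cmd.loop_induction (fun h (τ : State) => PartialSchedule (σ.arr .SR) (σ.arr .SP) n (σ.var .F)
    (σ.arr .D) (σ.arr .NX) m h (τ.var .e) (τ.var .C) (τ.var .lb) (τ.arr .S) (τ.arr .Q)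
    (τ.var .cnt)) ?_ ?_
  · refine ⟨by simp [hs], by simp [hs], ⟨m, by simpa [hs] using hT, by simp [hs]⟩, ?_, ?_, ?_, ?_,
      ?_, ?_, ?_, ?_⟩ <;> simp [hs, latest_self, hpos]
  · intro h τ hh hτ H
    have e₁ : τ.arr .SR = σ.arr .SR := hτ.arr .SR rfl
    have e₂ : τ.arr .SP = σ.arr .SP := hτ.arr .SP rfl
    have e₃ : τ.arr .NX = σ.arr .NX := hτ.arr .NX rfl
    by_cases he : h < τ.var .e
    · have hne : ¬ (τ.var .e - h = 0) := by omega
      have := H.next hr he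
      simpa [extractStep, hne, e₂] using this
    · have heq : τ.var .e = h := by have := H.le; omega
      rw [heq] at H
      obtain ⟨H', he'⟩ := H.newBatch hr hh
      have := H'.next hr he'
      simpa [extractStep, heq, e₁, e₂, e₃] using this

/-! ### Search over flow time bounds and numbers of batches -/

/-- The schedule recorded in a store, if any, has the recorded cost. -/
def Recorded (n : ℕ) (σ : State) : Prop :=
  σ.var .best = 0 ∨ ∃ F m, m ≤ n ∧ σ.var .best = F + m * σ.var .K + 1 ∧
    IsSchedule (σ.arr .SR) (σ.arr .SP) n F m (σ.arr .S) (σ.arr .Q) (σ.var .cnt)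

/-- A schedule is recorded that is at least as good as all those with flow times at most `F` and
with `m` replenishments. -/
def Beats (n : ℕ) (σ : State) (F m : ℕ) : Prop :=
  Good (σ.arr .SR) (σ.arr .SP) n F m 0 0 →
    0 < σ.var .best ∧ σ.var .best ≤ F + m * σ.var .K + 1

/-- The recorded schedule is not replaced by a worse one. -/
def Improves (σ τ : State) : Prop :=
  0 < σ.var .best → 0 < τ.var .best ∧ τ.var .best ≤ σ.var .best

theorem Improves.refl (σ : State) : Improves σ σ := fun h => ⟨h, le_rfl⟩

theorem Improves.trans {σ τ υ : State} (h : Improves σ τ) (h' : Improves τ υ) : Improves σ υ :=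
  fun h₀ => ⟨(h' (h h₀).1).1, (h' (h h₀).1).2.trans (h h₀).2⟩

theorem Beats.mono {n F m : ℕ} {σ τ : State} (h : Beats n σ F m) (hi : Improves σ τ)
    (hSR : τ.arr .SR = σ.arr .SR) (hSP : τ.arr .SP = σ.arr .SP) (hK : τ.var .K = σ.var .K) :
    Beats n τ F m := by
  intro hg
  rw [hSR, hSP] at hg
  have h₁ := h hg
  have h₂ := hi h₁.1
  rw [hK]
  omega

/-- The invariant of the loop over the layers. -/
structure LayersInv (n : ℕ) (σ : State) (m : ℕ) (τ : State) : Prop where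
  table : Table (τ.arr .SR) (τ.arr .SP) n (τ.var .F) (τ.arr .D) (τ.arr .NX) m (τ.var .base)
  fresh : ∀ a, τ.var .base + n < a → τ.arr .D a = 0
  val : τ.var .val = τ.var .F + m * τ.var .K + 1
  recorded : Recorded n τ
  improves : Improves σ τ
  beats : ∀ m', 1 ≤ m' → m' ≤ m → Beats n τ (τ.var .F) m'

theorem layerStep_spec {n m : ℕ} {σ τ : State} (hm : m < n)
    (hr : ∀ i j, i ≤ j → j ≤ n → τ.arr .SR i ≤ τ.arr .SR j) (h : LayersInv n σ m τ) :
    LayersInv n σ (m + 1) (layerStep.eval n τ) := by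
  set s₁ : State := (τ.setVar .base (τ.var .base + (n + 1))).setVar .val (τ.var .val + τ.var .K)
    with hs₁
  set s₂ := layer.eval n s₁ with hs₂
  have hbase₁ : s₁.var .base = τ.var .base + (n + 1) := by simp [hs₁]
  have hL : LayerInv n s₁ s₂ fun _ _ => True :=
    layer_spec (by omega) fun i hi => by
      rw [hbase₁]
      exact h.fresh _ (by omega)
  have hframe := layer.frame n s₁
  rw [← hs₂] at hframe
  have hbase : s₂.var .base = τ.var .base + (n + 1) := (hframe.var .base rfl).trans hbase₁
  have hval : s₂.var .val = τ.var .F + (m + 1) * τ.var .K + 1 := by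
    rw [hframe.var .val rfl]
    simp only [hs₁, Store.setVar_var, if_true, h.val]
    ring
  have hF : s₂.var .F = τ.var .F := hframe.var .F rfl
  have hK : s₂.var .K = τ.var .K := hframe.var .K rfl
  have hbest : s₂.var .best = τ.var .best := hframe.var .best rfl
  have hcnt : s₂.var .cnt = τ.var .cnt := hframe.var .cnt rfl
  have hSR : s₂.arr .SR = τ.arr .SR := hframe.arr .SR rfl
  have hSP : s₂.arr .SP = τ.arr .SP := hframe.arr .SP rfl
  have hS : s₂.arr .S = τ.arr .S := hframe.arr .S rfl
  have hQ : s₂.arr .Q = τ.arr .Q := hframe.arr .Q rfl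
  have hagree : ∀ a, a < τ.var .base + (n + 1) ∨ τ.var .base + (n + 1) + n < a →
      s₂.arr .D a = τ.arr .D a ∧ s₂.arr .NX a = τ.arr .NX a := by
    have := hL.agree
    rwa [hbase₁] at this
  have hT : Table (s₂.arr .SR) (s₂.arr .SP) n (s₂.var .F) (s₂.arr .D) (s₂.arr .NX) (m + 1)
      (s₂.var .base) := by
    rw [hSR, hSP, hF, hbase]
    have hstep := hL.step
    rw [hbase₁] at hstep
    refine ⟨by omega, hstep.congr (fun _ _ _ _ h => h) (fun i hi => ?_) (fun _ _ => rfl)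
      (fun _ _ => rfl), ?_⟩
    · exact (hagree _ (by omega)).1
    · rw [Nat.add_sub_cancel]
      exact h.table.congr (fun i hi => (hagree i (by omega)).1)
        (fun i hi => (hagree i (by omega)).2)
  have hfresh : ∀ a, s₂.var .base + n < a → s₂.arr .D a = 0 := by
    intro a ha
    rw [(hagree a (by omega)).1]
    exact h.fresh a (by omega)
  have hrec : Recorded n s₂ := by
    have := h.recorded
    rwa [Recorded, ← hbest, ← hK, ← hSR, ← hSP, ← hS, ← hQ, ← hcnt] at this
  have himp : Improves τ s₂ := fun h => by rw [hbest]; exact ⟨h, le_rfl⟩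
  have hbeats : ∀ m', 1 ≤ m' → m' ≤ m → Beats n s₂ (s₂.var .F) m' := by
    intro m' h₁ h₂
    rw [hF]
    exact (h.beats m' h₁ h₂).mono himp hSR hSP hK
  have hval₂ : s₂.var .val = s₂.var .F + (m + 1) * s₂.var .K + 1 := by rw [hval, hF, hK]
  have hr₂ : ∀ i j, i ≤ j → j ≤ n → s₂.arr .SR i ≤ s₂.arr .SR j := by rwa [hSR]
  have heval : layerStep.eval n τ = if s₂.arr .D (s₂.var .base) = 0 then s₂ else
      if s₂.var .best - s₂.var .val + (1 - s₂.var .best) = 0 then s₂ else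
        extract.eval n (s₂.setVar .best (s₂.var .val)) := by
    simp [layerStep, ← hs₁, ← hs₂]
  have keep (hb : Beats n s₂ (s₂.var .F) (m + 1)) : LayersInv n σ (m + 1) s₂ := by
    refine ⟨hT, hfresh, hval₂, hrec, h.improves.trans himp, fun m' h₁ h₂ => ?_⟩
    rcases (show m' ≤ m ∨ m' = m + 1 by omega) with h₂ | rfl
    exacts [hbeats m' h₁ h₂, hb]
  rw [heval]
  split_ifs with h₁ h₂
  -- A zero bound at job `0` excludes any solution with `m + 1` batches, by completeness.
  · refine keep fun hg => ?_
    have := hT.lt_of_good hr₂ (Nat.zero_le _) hg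
    rw [add_zero] at this
    omega
  · exact keep fun _ => by omega
  · set s₃ := s₂.setVar .best (s₂.var .val) with hs₃
    have hsched := extract_spec (n := n) (m := m + 1) (σ := s₃) hr₂
      (by simpa [hs₃] using hT) (by simp [hs₃]; omega)
    have hframe := extract.frame n s₃
    set s₄ := extract.eval n s₃
    have hbest₄ : s₄.var .best = s₂.var .val := by
      rw [hframe.var .best rfl]
      simp [hs₃]
    have hK₄ : s₄.var .K = s₂.var .K := hframe.var .K rfl
    have hF₄ : s₄.var .F = s₂.var .F := hframe.var .F rfl
    have hSR₄ : s₄.arr .SR = s₂.arr .SR := hframe.arr .SR rfl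
    have hSP₄ : s₄.arr .SP = s₂.arr .SP := hframe.arr .SP rfl
    have hD₄ : s₄.arr .D = s₂.arr .D := hframe.arr .D rfl
    have hNX₄ : s₄.arr .NX = s₂.arr .NX := hframe.arr .NX rfl
    have hbase₄ : s₄.var .base = s₂.var .base := hframe.var .base rfl
    have hval₄ : s₄.var .val = s₂.var .val := hframe.var .val rfl
    have himp₄ : Improves s₂ s₄ := fun _ => by omega
    refine ⟨by rwa [hSR₄, hSP₄, hF₄, hD₄, hNX₄, hbase₄], by rwa [hbase₄, hD₄],
      by rw [hval₄, hF₄, hK₄, hval₂], .inr ⟨s₂.var .F, m + 1, hm, ?_, ?_⟩,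
      h.improves.trans (himp.trans himp₄), fun m' h₁ h₂ => ?_⟩
    · rw [hbest₄, hK₄, hval₂]
    · rw [hSR₄, hSP₄]
      exact hsched
    · rw [hF₄]
      rcases (show m' ≤ m ∨ m' = m + 1 by omega) with h₂ | rfl
      · exact (hbeats m' h₁ h₂).mono himp₄ hSR₄ hSP₄ hK₄
      · intro _
        rw [hbest₄, hK₄, hval₂]
        omega

/-- The invariant of the search for the maximum flow time: the memory from `base` on is unused. -/
structure SearchInv (n : ℕ) (τ : State) : Prop where
  fresh : ∀ a, τ.var .base ≤ a → τ.arr .D a = 0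
  recorded : Recorded n τ

theorem tryBound_spec {n : ℕ} {σ : State}
    (hr : ∀ i j, i ≤ j → j ≤ n → σ.arr .SR i ≤ σ.arr .SR j) (h : SearchInv n σ) :
    SearchInv n (tryBound.eval n σ) ∧ Improves σ (tryBound.eval n σ) ∧
      ∀ m, 1 ≤ m → Beats n (tryBound.eval n σ) (σ.var .F) m := by
  set s : State := (σ.setArr .D (σ.var .base + n) (σ.var .F + σ.arr .SR n + 1)).setVar .val
    (σ.var .F + 1) with hs
  have heval : tryBound.eval n σ = ((Cmd.loop .m layerStep).eval n s).setVar .base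
      (((Cmd.loop .m layerStep).eval n s).var .base + (n + 1)) := by
    simp [tryBound, hs]
  have hinv := Cmd.loop_induction (n := n) (x := .m) (c := layerStep) (σ := s)
    (fun m τ => LayersInv n s m τ) ?_ ?_
  · have hframe := (Cmd.loop .m layerStep).frame n s
    set s' := (Cmd.loop .m layerStep).eval n s
    rw [heval]
    refine ⟨⟨fun a ha => hinv.fresh a (by simp at ha; omega),
        by simpa [Recorded] using hinv.recorded⟩,
      by simpa [Improves, hs] using hinv.improves, fun m hm hg => ?_⟩
    have hF : s'.var .F = σ.var .F := hframe.var .F rfl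
    have := hinv.beats m hm
    rw [hF] at this
    -- Batches are nonempty, so the `n` layers computed cover every possible `m`.
    simpa using this (hg.add_le) (by simpa using hg)
  · refine ⟨⟨by simp [hs], fun i hi => ?_⟩, fun a ha => ?_, by simp [hs], ?_, .refl _,
      fun m' h₁ h₂ => by omega⟩
    · have := h.fresh (σ.var .base + i) (by omega)
      simpa [hs, Function.update_apply, hi.ne] using this
    · have ha' : σ.var .base + n < a := by simpa [hs] using ha
      have := h.fresh a (by omega)
      simpa [hs, Function.update_apply, ha'.ne'] using this
    · simpa [Recorded, hs] using h.recorded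
  · intro m τ hm hτ hinv
    have := layerStep_spec (n := n) (m := m) (σ := s) (τ := τ.setVar .m m) hm (by
      have : τ.arr .SR = σ.arr .SR := hτ.arr .SR rfl
      simpa [this] using hr) ?_
    · exact this
    · exact ⟨by simpa using hinv.table, by simpa using hinv.fresh, by simpa using hinv.val,
        by simpa [Recorded] using hinv.recorded, by simpa [Improves] using hinv.improves,
        by simpa [Beats] using hinv.beats⟩

/-- The three loops enumerate the triples in `IsCandidate`. What one round has beaten stays beaten,
since the recorded cost never increases. -/
theorem search_spec {n : ℕ} {σ : State}
    (hr : ∀ i j, i ≤ j → j ≤ n → σ.arr .SR i ≤ σ.arr .SR j) (h : SearchInv n σ) :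
    Recorded n (search.eval n σ) ∧
      ∀ F, IsCandidate (σ.arr .SR) (σ.arr .SP) n F → ∀ m, 1 ≤ m →
        Beats n (search.eval n σ) F m := by
  set r := σ.arr .SR with hr'
  set p := σ.arr .SP with hp'
  set cand : ℕ → ℕ → ℕ → ℕ := fun a b l => r a + ∑ y ∈ Finset.Ico b (l + 1), p y - r l with hcand
  have hinv := Cmd.loop_induction (n := n) (σ := σ) (x := .a)
    (c := .loop .b (.block [.set .acc (.get .SR (v .a)), .loop .l candidateStep]))
    (fun a τ => SearchInv n τ ∧ ∀ a' < a, ∀ b l, b ≤ l → l < n → ∀ m, 1 ≤ m →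
      Beats n τ (cand a' b l) m) ⟨h, fun a' ha' => by omega⟩ ?_
  · refine ⟨hinv.1.recorded, ?_⟩
    rintro F ⟨a, b, l, ha, hb, hl, rfl⟩ m hm
    exact hinv.2 a ha b l hb hl m hm
  · rintro a τ ha hτ ⟨hs, hbeats⟩
    have hSR : τ.arr .SR = r := hτ.arr .SR rfl
    have hSP : τ.arr .SP = p := hτ.arr .SP rfl
    have hinv := Cmd.loop_induction (n := n) (σ := τ.setVar .a a) (x := .b)
      (c := .block [.set .acc (.get .SR (v .a)), .loop .l candidateStep])
      (fun b υ => SearchInv n υ ∧ Improves τ υ ∧ ∀ b' < b, ∀ l, b' ≤ l → l < n → ∀ m, 1 ≤ m →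
        Beats n υ (cand a b' l) m)
      ⟨⟨by simpa using hs.fresh, by simpa [Recorded] using hs.recorded⟩,
        by simp [Improves], fun b' hb' => by omega⟩ ?_
    · have hframe := (Cmd.loop .b (.block [.set .acc (.get .SR (v .a)),
        .loop .l candidateStep])).frame n (τ.setVar .a a)
      refine ⟨hinv.1, fun a' ha' b l hb hl m hm => ?_⟩
      rcases (show a' < a ∨ a' = a by omega) with ha' | rfl
      · exact (hbeats a' ha' b l hb hl m hm).mono hinv.2.1 (hframe.arr .SR rfl)
          (hframe.arr .SP rfl) (hframe.var .K rfl)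
      · exact hinv.2.2 b (by omega) l hb hl m hm
    · rintro b υ hb hυ ⟨hs, himp, hbeats⟩
      have hSR' : υ.arr .SR = r := (hυ.arr .SR rfl).trans hSR
      have hSP' : υ.arr .SP = p := (hυ.arr .SP rfl).trans hSP
      have ha' : υ.var .a = a := (hυ.var .a rfl).trans (by simp)
      set s : State := (υ.setVar .b b).setVar .acc (r a) with hs'
      have heval : Cmd.eval n (.block [.set .acc (.get .SR (v .a)), .loop .l candidateStep])
          (υ.setVar .b b) = (Cmd.loop .l candidateStep).eval n s := by
        simp [ha', hSR', hs']
      rw [heval]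
      have hinv := Cmd.loop_induction (n := n) (σ := s) (x := .l) (c := candidateStep)
        (fun l φ => φ.var .acc = r a + ∑ y ∈ Finset.Ico b l, p y ∧ SearchInv n φ ∧
          Improves υ φ ∧ ∀ l' < l, b ≤ l' → ∀ m, 1 ≤ m → Beats n φ (cand a b l') m)
        ⟨by simp [hs'], ⟨by simpa [hs'] using hs.fresh, by simpa [hs', Recorded] using hs.recorded⟩,
          by simp [Improves, hs'], fun l' hl' => by omega⟩ ?_
      · have hframe := (Cmd.loop .l candidateStep).frame n s
        refine ⟨hinv.2.1, himp.trans hinv.2.2.1, fun b' hb' l hl hln m hm => ?_⟩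
        rcases (show b' < b ∨ b' = b by omega) with hb' | rfl
        · exact (hbeats b' hb' l hl hln m hm).mono hinv.2.2.1 (hframe.arr .SR rfl)
            (hframe.arr .SP rfl) (hframe.var .K rfl)
        · exact hinv.2.2.2 l hln hl m hm
      · rintro l φ hl hφ ⟨hacc, hs, himp, hbeats⟩
        have hb' : φ.var .b = b := (hφ.var .b rfl).trans (by simp [hs'])
        have hSR'' : φ.arr .SR = r := (hφ.arr .SR rfl).trans hSR'
        have hSP'' : φ.arr .SP = p := (hφ.arr .SP rfl).trans hSP'
        by_cases hbl : b ≤ l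
        · have hne : ¬ (l + 1 - b = 0) := by omega
          set s' : State := ((φ.setVar .l l).setVar .acc (φ.var .acc + p l)).setVar .F
            (φ.var .acc + p l - r l) with hs''
          have heval : candidateStep.eval n (φ.setVar .l l) = tryBound.eval n s' := by
            simp [candidateStep, hb', hne, hSR'', hSP'', hs'']
          rw [heval]
          have hacc' : φ.var .acc + p l = r a + ∑ y ∈ Finset.Ico b (l + 1), p y := by
            rw [hacc, Finset.sum_Ico_succ_top hbl, add_assoc]
          have hF : s'.var .F = cand a b l := by simp [hs'', hcand, hacc']
          obtain ⟨h₁, h₂, h₃⟩ := tryBound_spec (n := n) (σ := s') (by simpa [hs'', hSR''] using hr)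
            ⟨by simpa [hs''] using hs.fresh, by simpa [hs'', Recorded] using hs.recorded⟩
          have hframe := tryBound.frame n s'
          have himp' : Improves φ (tryBound.eval n s') := by simpa [Improves, hs''] using h₂
          refine ⟨?_, h₁, himp.trans himp', fun l' hl' hb m hm => ?_⟩
          · rw [hframe.var .acc rfl, ← hacc']
            simp [hs'']
          · rcases (show l' < l ∨ l' = l by omega) with hl' | rfl
            · exact (hbeats l' hl' hb m hm).mono himp' (hframe.arr .SR rfl) (hframe.arr .SP rfl)
                (hframe.var .K rfl)
            · rw [← hF]
              exact h₃ m hm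
        · have hz : l + 1 - b = 0 := by omega
          have heval : candidateStep.eval n (φ.setVar .l l) = φ.setVar .l l := by
            simp [candidateStep, hb', hz]
          rw [heval]
          refine ⟨?_, ⟨by simpa using hs.fresh, by simpa [Recorded] using hs.recorded⟩,
            by simpa [Improves] using himp, fun l' hl' hb m hm => by omega⟩
          rw [Finset.Ico_eq_empty (by omega)] at hacc ⊢
          simpa using hacc

end JRP
namespace JRP

open RAM

/-! ### Sorting the jobs -/

/-- The job `l` precedes the job `j`: it is released earlier, or at the same time and has a smaller
number. -/
def Precedes (R : ℕ → ℕ) (l j : ℕ) : Prop := R l < R j + (1 - (1 - (j - l)))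

instance (R : ℕ → ℕ) (j : ℕ) : DecidablePred fun l => Precedes R l j :=
  fun l => inferInstanceAs (Decidable (R l < R j + (1 - (1 - (j - l)))))

/-- The position of the job `j` in the sorted sequence. -/
def rank (R : ℕ → ℕ) (n j : ℕ) : ℕ := Nat.count (fun l => Precedes R l j) n

theorem rank_lt_rank {R : ℕ → ℕ} {n l j : ℕ} (hl : l < n) (h : Precedes R l j) :
    rank R n l < rank R n j := by
  rw [rank, rank, Nat.count_eq_card_filter_range, Nat.count_eq_card_filter_range]
  refine Finset.card_lt_card ((Finset.ssubset_iff_of_subset fun i => ?_).2 ⟨l, ?_, ?_⟩)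
  · simp only [Finset.mem_filter]
    rintro ⟨hi, h'⟩
    refine ⟨hi, ?_⟩
    simp only [Precedes] at *
    omega
  · simp [hl, h]
  · rw [Finset.mem_filter]
    simp [Precedes]

theorem rank_lt {R : ℕ → ℕ} {n j : ℕ} (hj : j < n) : rank R n j < n := by
  rw [rank, Nat.count_eq_card_filter_range]
  conv_rhs => rw [← Finset.card_range n]
  refine Finset.card_lt_card ((Finset.ssubset_iff_of_subset (Finset.filter_subset _ _)).2 ⟨j, ?_, ?_⟩)
  · simpa using hj
  · rw [Finset.mem_filter]
    simp [Precedes]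

theorem rank_ne_rank {R : ℕ → ℕ} {n l j : ℕ} (hl : l < n) (hj : j < n) (h : l ≠ j) :
    rank R n l ≠ rank R n j := by
  have : Precedes R l j ∨ Precedes R j l := by
    simp only [Precedes]
    omega
  rcases this with h | h
  · exact (rank_lt_rank hl h).ne
  · exact (rank_lt_rank hj h).ne'

theorem sortStep_spec {n j : ℕ} {σ : State} :
    let s := sortStep.eval n (σ.setVar .j j)
    s.arr .RK = Function.update (σ.arr .RK) j (rank (σ.arr .R) n j) ∧
    s.arr .SR = Function.update (σ.arr .SR) (rank (σ.arr .R) n j) (σ.arr .R j) ∧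
    s.arr .SP = Function.update (σ.arr .SP) (rank (σ.arr .R) n j) (σ.arr .P j) := by
  set s₁ : State := (σ.setVar .j j).setVar .rk 0 with hs₁
  have hframe := (Cmd.loop .l rankStep).frame n s₁
  have hrk : ((Cmd.loop .l rankStep).eval n s₁).var .rk = rank (σ.arr .R) n j := by
    refine Cmd.loop_induction (fun l (τ : State) =>
      τ.var .rk = Nat.count (fun l => Precedes (σ.arr .R) l j) l) (by simp [hs₁]) ?_
    intro l τ hl hτ hinv
    have hj : τ.var .j = j := (hτ.var .j rfl).trans (by simp [hs₁])
    have hR : τ.arr .R = σ.arr .R := hτ.arr .R rfl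
    rw [Nat.count_succ, ← hinv]
    by_cases h : Precedes (σ.arr .R) l j
    · have hne : ¬ (σ.arr .R j + (1 - (1 - (j - l))) - σ.arr .R l = 0) := by
        simp only [Precedes] at h
        omega
      simp [rankStep, hj, hR, hne, h]
    · have hz : σ.arr .R j + (1 - (1 - (j - l))) - σ.arr .R l = 0 := by
        simp only [Precedes] at h
        omega
      simp [rankStep, hj, hR, hz, h]
  have hj : ((Cmd.loop .l rankStep).eval n s₁).var .j = j :=
    (hframe.var .j rfl).trans (by simp [hs₁])
  have hR : ((Cmd.loop .l rankStep).eval n s₁).arr .R = σ.arr .R := hframe.arr .R rfl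
  have hP : ((Cmd.loop .l rankStep).eval n s₁).arr .P = σ.arr .P := hframe.arr .P rfl
  have hRK : ((Cmd.loop .l rankStep).eval n s₁).arr .RK = σ.arr .RK := hframe.arr .RK rfl
  have hSR : ((Cmd.loop .l rankStep).eval n s₁).arr .SR = σ.arr .SR := hframe.arr .SR rfl
  have hSP : ((Cmd.loop .l rankStep).eval n s₁).arr .SP = σ.arr .SP := hframe.arr .SP rfl
  simp [sortStep, ← hs₁, hrk, hj, hR, hP, hRK, hSR, hSP]

/-- Precedence is a strict total order, so the numbers of predecessors are distinct and below `n`;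
an injective self-map of a finite set is a permutation. -/
theorem sort_spec {n : ℕ} {σ : State} (hT : ∀ j < n, σ.arr .R j < σ.var .T) :
    (∃ π : Fin n ≃ Fin n, ∀ j : Fin n, (sort.eval n σ).arr .RK j = π j ∧
      (sort.eval n σ).arr .SR (π j) = σ.arr .R j ∧ (sort.eval n σ).arr .SP (π j) = σ.arr .P j) ∧
    (∀ i j, i ≤ j → j ≤ n → (sort.eval n σ).arr .SR i ≤ (sort.eval n σ).arr .SR j) ∧
    ∀ i < n, (sort.eval n σ).arr .SR i < (sort.eval n σ).arr .SR n := by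
  have hinv := Cmd.loop_induction (n := n) (x := .j) (c := sortStep) (σ := σ)
    (fun j τ => ∀ i < j, τ.arr .RK i = rank (σ.arr .R) n i ∧
      τ.arr .SR (rank (σ.arr .R) n i) = σ.arr .R i ∧
      τ.arr .SP (rank (σ.arr .R) n i) = σ.arr .P i) (fun i hi => by omega) ?_
  · have hframe := (Cmd.loop .j sortStep).frame n σ
    set τ := (Cmd.loop .j sortStep).eval n σ with hτ
    have hT' : τ.var .T = σ.var .T := hframe.var .T rfl
    have hRK : (sort.eval n σ).arr .RK = τ.arr .RK := by simp [sort, hτ]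
    have hSP : (sort.eval n σ).arr .SP = τ.arr .SP := by simp [sort, hτ]
    have hSR : (sort.eval n σ).arr .SR = Function.update (τ.arr .SR) n (σ.var .T) := by
      simp [sort, ← hτ, hT']
    let f : Fin n → Fin n := fun j => ⟨rank (σ.arr .R) n j, rank_lt j.2⟩
    have hf : f.Injective := by
      intro i j hij
      by_contra h
      exact rank_ne_rank i.2 j.2 (fun h' => h (Fin.ext h')) (Fin.mk.inj hij)
    have hfb : f.Bijective := Finite.injective_iff_bijective.1 hf
    have hSR' : ∀ j : Fin n, (sort.eval n σ).arr .SR (f j) = σ.arr .R j := by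
      intro j
      rw [hSR, Function.update_of_ne (f j).2.ne]
      exact (hinv j j.2).2.1
    have hlast : ∀ i < n, (sort.eval n σ).arr .SR i < (sort.eval n σ).arr .SR n := by
      intro i hi
      obtain ⟨j, hj⟩ := hfb.2 ⟨i, hi⟩
      have := hSR' j
      rw [hj] at this
      rw [this, hSR, Function.update_self]
      exact hT j j.2
    refine ⟨⟨Equiv.ofBijective f hfb, fun j => ⟨?_, hSR' j, ?_⟩⟩, fun i j hij hj => ?_, hlast⟩
    · rw [hRK]
      exact (hinv j j.2).1
    · rw [hSP]
      exact (hinv j j.2).2.2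
    · rcases hij.eq_or_lt with rfl | hij
      · exact le_rfl
      rcases hj.eq_or_lt with rfl | hj
      · exact (hlast i hij).le
      obtain ⟨a, ha⟩ := hfb.2 ⟨i, hij.trans hj⟩
      obtain ⟨b, hb⟩ := hfb.2 ⟨j, hj⟩
      have h₁ := hSR' a
      have h₂ := hSR' b
      have h₃ : rank (σ.arr .R) n a = i := congrArg Fin.val ha
      have h₄ : rank (σ.arr .R) n b = j := congrArg Fin.val hb
      rw [ha] at h₁
      rw [hb] at h₂
      rw [h₁, h₂]
      -- Otherwise the job at position `j` would precede the one at position `i` and have the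
      -- smaller rank.
      by_contra h
      have := rank_lt_rank (R := σ.arr .R) (n := n) b.2 (show Precedes (σ.arr .R) b a by
        simp only [Precedes]
        omega)
      omega
  · intro j τ hj hτ hinv i hi
    have hR : τ.arr .R = σ.arr .R := hτ.arr .R rfl
    have hP : τ.arr .P = σ.arr .P := hτ.arr .P rfl
    obtain ⟨h₁, h₂, h₃⟩ := sortStep_spec (n := n) (j := j) (σ := τ)
    rw [h₁, h₂, h₃, hR, hP]
    rcases (show i < j ∨ i = j by omega) with hi | rfl
    · have := rank_ne_rank (R := σ.arr .R) (hi.trans hj) hj hi.ne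
      rw [Function.update_of_ne hi.ne, Function.update_of_ne this, Function.update_of_ne this]
      exact hinv i hi
    · simp

/-! ### Input and output -/

/-- The presentation of a job. -/
def Instance.encodeJob (I : Instance 1) (j : Fin I.n) : List ℕ := [I.r j, I.p j] ++ bits (I.req j)

theorem bits_of_nonempty {A : Finset (Fin 1)} (h : A.Nonempty) : bits A = [1] := by
  obtain ⟨i, hi⟩ := h
  obtain rfl := Subsingleton.elim i 0
  simp [bits, hi]

theorem readInput_spec (I : Instance 1) :
    let s := readInput.eval I.n (Store.ofInput
      (I.K₀ :: I.K 0 :: (List.ofFn I.encodeJob).flatten) : State)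
    s.var .K = I.K₀ + I.K 0 ∧
    ∀ j : Fin I.n, s.arr .R j = I.r j ∧ s.arr .P j = I.p j ∧ s.arr .R j < s.var .T := by
  set σ : State := Store.ofInput (I.K₀ :: I.K 0 :: (List.ofFn I.encodeJob).flatten) with hσ
  set s₁ := Cmd.eval I.n (.block [.read .K, .read .t, .set .K (v .K + v .t)]) σ with hs₁
  have heval : readInput.eval I.n σ = (Cmd.loop .j readStep).eval I.n s₁ := rfl
  have hframe := (Cmd.loop .j readStep).frame I.n s₁
  have hinv := Cmd.loop_induction (n := I.n) (x := .j) (c := readStep) (σ := s₁)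
    (fun j τ => τ.input = ((List.ofFn I.encodeJob).drop j).flatten ∧ ∀ i : Fin I.n, i < j →
      τ.arr .R i = I.r i ∧ τ.arr .P i = I.p i ∧ τ.arr .R i < τ.var .T) ?_ ?_
  · rw [heval]
    refine ⟨?_, fun j => hinv.2 j j.2⟩
    rw [hframe.var .K rfl]
    simp [hs₁, hσ, Store.ofInput]
  · exact ⟨by simp [hs₁, hσ, Store.ofInput], fun i hi => by omega⟩
  · rintro j τ hj hτ ⟨hin, hinv⟩
    rw [List.drop_eq_getElem_cons (by simpa using hj)] at hin
    simp only [List.getElem_ofFn, List.flatten_cons, Instance.encodeJob,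
      bits_of_nonempty (I.req_nonempty _), List.cons_append, List.nil_append] at hin
    refine ⟨by simp [readStep, hin],
      fun i hi => ?_⟩
    rcases (show (i : ℕ) < j ∨ (i : ℕ) = j by omega) with hi | hi
    · obtain ⟨h₁, h₂, h₃⟩ := hinv i hi
      refine ⟨by simp [readStep, hin, hi.ne, h₁], by simp [readStep, hin, hi.ne, h₂], ?_⟩
      simp [readStep, hin, hi.ne]
      omega
    · have : (⟨j, hj⟩ : Fin I.n) = i := Fin.ext hi.symm
      rw [this] at hin
      refine ⟨by simp [readStep, hin, hi], by simp [readStep, hin, hi], ?_⟩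
      simp [readStep, hin, hi]
      omega

theorem writeOutput_spec {n : ℕ} {σ : State} (hcnt : σ.var .cnt ≤ n) (hout : σ.output = []) :
    (writeOutput.eval n σ).output = [σ.var .cnt] ++
      ((List.range (σ.var .cnt)).map fun c => [σ.arr .Q c, 1]).flatten ++
      (List.range n).map fun j => σ.arr .S (σ.arr .RK j) := by
  set s₁ : State := { σ with output := [σ.var .cnt] } with hs₁
  set s₂ := (Cmd.loop .j writeReplStep).eval n s₁ with hs₂
  have heval : writeOutput.eval n σ = (Cmd.loop .j writeStartStep).eval n s₂ := by
    simp [writeOutput, hout, ← hs₁, hs₂]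
  have h₂ : s₂.output = [σ.var .cnt] ++
      ((List.range (σ.var .cnt)).map fun c => [σ.arr .Q c, 1]).flatten := by
    have := Cmd.loop_induction (n := n) (x := .j) (c := writeReplStep) (σ := s₁)
      (fun j τ => τ.output = [σ.var .cnt] ++
        ((List.range (min j (σ.var .cnt))).map fun c => [σ.arr .Q c, 1]).flatten)
      (by simp [hs₁]) ?_
    · rwa [min_eq_right hcnt] at this
    · intro j τ hj hτ hinv
      have hc : τ.var .cnt = σ.var .cnt := hτ.var .cnt rfl
      have hQ : τ.arr .Q = σ.arr .Q := hτ.arr .Q rfl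
      rcases Nat.lt_or_ge j (σ.var .cnt) with h | h
      · have hne : ¬ (σ.var .cnt - j = 0) := by omega
        rw [min_eq_left h.le] at hinv
        rw [min_eq_left (show j + 1 ≤ σ.var .cnt from h), List.range_succ]
        simp [writeReplStep, hc, hQ, hne, hinv]
      · have hz : σ.var .cnt - j = 0 := by omega
        rw [min_eq_right h] at hinv
        rw [min_eq_right (show σ.var .cnt ≤ j + 1 by omega)]
        simp [writeReplStep, hc, hz, hinv]
  have hframe := (Cmd.loop .j writeReplStep).frame n s₁
  rw [heval, ← h₂]
  refine Cmd.loop_induction (fun j (τ : State) => τ.output = s₂.output ++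
    (List.range j).map fun j => σ.arr .S (σ.arr .RK j)) (by simp) ?_
  intro j τ hj hτ hinv
  have hS : τ.arr .S = σ.arr .S := (hτ.arr .S rfl).trans (hframe.arr .S rfl)
  have hRK : τ.arr .RK = σ.arr .RK := (hτ.arr .RK rfl).trans (hframe.arr .RK rfl)
  rw [List.range_succ]
  simp [writeStartStep, hS, hRK, hinv]

/-! ### Optimality -/

/-- Replenishments of the empty set may occur and cost `K₀`, but they serve no job and can be
ignored. -/
theorem length_filter_mul_le (I : Instance 1) (L : List (Finset (Fin 1) × ℝ)) :
    ((L.filter fun e => 0 ∈ e.1).length : ℝ) * (I.K₀ + I.K 0 : ℕ) ≤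
      (L.map fun e => (I.K₀ : ℝ) + ∑ i ∈ e.1, (I.K i : ℝ)).sum := by
  induction L with
  | nil => simp
  | cons e L ih =>
    rw [List.map_cons, List.sum_cons]
    have h₀ : (0 : ℝ) ≤ ∑ i ∈ e.1, (I.K i : ℝ) := Finset.sum_nonneg fun _ _ => Nat.cast_nonneg _
    by_cases h : 0 ∈ e.1
    · have h₁ : (I.K 0 : ℝ) ≤ ∑ i ∈ e.1, (I.K i : ℝ) :=
        Finset.single_le_sum (f := fun i => (I.K i : ℝ)) (fun _ _ => Nat.cast_nonneg _) h
      rw [List.filter_cons_of_pos (by simpa using h)]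
      push_cast [List.length_cons] at ih ⊢
      linarith
    · rw [List.filter_cons_of_neg (by simpa using h)]
      have : (0 : ℝ) ≤ I.K₀ := Nat.cast_nonneg _
      linarith

/-- The jobs of an instance, sorted by release date: the job `j` has the number `π j`. -/
structure Instance.Sorted (I : Instance 1) (π : Fin I.n ≃ Fin I.n) (r p : ℕ → ℕ) : Prop where
  release : ∀ j, r (π j) = I.r j
  processing : ∀ j, p (π j) = I.p j
  mono : ∀ i j, i ≤ j → j ≤ I.n → r i ≤ r j
  last : ∀ i < I.n, r i < r I.n

theorem Instance.Feasible.release_le_start {I : Instance 1} {σ : Solution I.n 1 ℝ}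
    (h : I.Feasible σ) (j : Fin I.n) : (I.r j : ℝ) ≤ σ.start j := by
  obtain ⟨i, hi⟩ := I.req_nonempty j
  obtain ⟨e, -, -, h₁, h₂⟩ := h.ready j i hi
  exact h₁.trans h₂

theorem Instance.flowTime_le_Fmax (I : Instance 1) (σ : Solution I.n 1 ℝ) (j : Fin I.n) :
    I.flowTime σ j ≤ I.Fmax σ :=
  le_ciSup (f := fun j => I.flowTime σ j) (Set.finite_range _).bddAbove j

theorem Instance.Feasible.exists_good {I : Instance 1} {π : Fin I.n ≃ Fin I.n} {r p : ℕ → ℕ}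
    (hs : I.Sorted π r p) (hn : 0 < I.n) {σ : Solution I.n 1 ℝ} (h : I.Feasible σ) :
    ∃ F m : ℕ, Good r p I.n F m 0 0 ∧ (F : ℝ) + m * (I.K₀ + I.K 0 : ℕ) ≤ I.cost σ := by
  set S : ℕ → ℝ := fun l => if h : l < I.n then σ.start (π.symm ⟨l, h⟩) else 0 with hS
  have hSl : ∀ l (hl : l < I.n), S l = σ.start (π.symm ⟨l, hl⟩) := fun l hl => by simp [hS, hl]
  have hrl : ∀ l (hl : l < I.n), r l = I.r (π.symm ⟨l, hl⟩) := fun l hl => by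
    rw [← hs.release, Equiv.apply_symm_apply]
  have hpl : ∀ l (hl : l < I.n), p l = I.p (π.symm ⟨l, hl⟩) := fun l hl => by
    rw [← hs.processing, Equiv.apply_symm_apply]
  set Q : List ℝ := (σ.repl.filter fun e => 0 ∈ e.1).map Prod.snd with hQ
  have hF : 0 ≤ I.Fmax σ := by
    refine le_trans ?_ (I.flowTime_le_Fmax σ ⟨0, hn⟩)
    have h₁ := h.release_le_start ⟨0, hn⟩
    have h₂ : (0 : ℝ) ≤ I.p ⟨0, hn⟩ := Nat.cast_nonneg _
    simp only [Instance.flowTime]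
    linarith
  obtain ⟨m, hm, hg⟩ := exists_good_of_schedule (r := r) (p := p) (n := I.n) hs.mono hs.last
    (fun i hi => by rw [hpl i hi]; exact I.p_pos _) (S := S) (f := I.Fmax σ) (Q := Q) (i := 0)
    (C := 0)
    (fun i hi j hj hij => by
      rw [hSl i hi, hSl j hj, hpl i hi, hpl j hj]
      exact h.disjoint _ _ fun h' => hij (by simpa using h'))
    (fun i hi => by
      rw [hSl i hi, hpl i hi, hrl i hi]
      exact I.flowTime_le_Fmax σ _)
    (List.pairwise_map.2 (h.increasing.filter _)) (Nat.zero_le _)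
    (fun l _ hl => by
      rw [hSl l hl, hrl l hl]
      obtain ⟨i, hi⟩ := I.req_nonempty (π.symm ⟨l, hl⟩)
      obtain ⟨e, he, hie, h₁, h₂⟩ := h.ready _ i hi
      rw [Subsingleton.elim i 0] at hie
      exact ⟨e.2, List.mem_map.2 ⟨e, List.mem_filter.2 ⟨he, by simpa using hie⟩, rfl⟩, h₁, h₂⟩)
    ⟨0, 0, le_rfl, by simp, fun l _ hl => by
      rw [hSl l hl]
      exact_mod_cast (Nat.cast_nonneg _).trans (h.release_le_start _)⟩
  refine ⟨_, m, hg, add_le_add (Nat.floor_le hF) (le_trans ?_ (length_filter_mul_le I σ.repl))⟩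
  rw [hQ, List.length_map] at hm
  gcongr

/-- `F` and `m` need only bound the maximum flow time and the number of replenishments from above:
if these upper bounds already match the optimum, the schedule is optimal. -/
theorem IsSchedule.isAnswer {I : Instance 1} {π : Fin I.n ≃ Fin I.n} {r p : ℕ → ℕ}
    (hs : I.Sorted π r p) {F m cnt : ℕ} {S Q : ℕ → ℕ} (h : IsSchedule r p I.n F m S Q cnt)
    (hopt : ∀ σ : Solution I.n 1 ℝ, I.Feasible σ →
      (F : ℝ) + m * (I.K₀ + I.K 0 : ℕ) ≤ I.cost σ) {pos : ℕ → ℕ} (hpos : ∀ j : Fin I.n, pos j = π j) :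
    I.IsAnswer ([cnt] ++ ((List.range cnt).map fun c => [Q c, 1]).flatten ++
      (List.range I.n).map fun j => S (pos j)) := by
  set σ : Solution I.n 1 ℕ :=
    ⟨fun j => S (π j), (List.range cnt).map fun c => ({0}, Q c)⟩ with hσ
  refine ⟨σ, ?_, ⟨?_, ?_, ?_⟩, fun σ' h' => le_trans ?_ (hopt σ' h')⟩
  · have h₁ : bits ({0} : Finset (Fin 1)) = [1] := bits_of_nonempty (by simp)
    have h₂ : (List.range I.n).map (fun j => S (pos j)) = List.ofFn fun j : Fin I.n => S (π j) := by
      rw [← List.map_coe_finRange_eq_range, List.map_map, List.ofFn_eq_map]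
      exact List.map_congr_left fun j _ => by simp [hpos]
    simp [Solution.encode, hσ, h₂, h₁, Function.comp_def]
  · simp only [Solution.toReal, hσ, List.map_map, List.pairwise_map, Function.comp_apply]
    refine List.pairwise_lt_range.imp_of_mem fun _ hc' hlt => ?_
    exact_mod_cast h.increasing _ _ hlt (List.mem_range.1 hc')
  · intro j k hjk
    have hne : (π j : ℕ) ≠ π k := fun e => hjk (π.injective (Fin.ext e))
    simp only [Solution.toReal, hσ, ← hs.processing]
    rcases lt_or_gt_of_ne hne with hlt | hlt
    · exact .inl (by exact_mod_cast h.disjoint _ _ hlt (π k).2)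
    · exact .inr (by exact_mod_cast h.disjoint _ _ hlt (π j).2)
  · intro j i _
    obtain ⟨c, hc, h₁, h₂⟩ := h.ready (π j) (π j).2
    refine ⟨({0}, (Q c : ℝ)), ?_, by simp [Subsingleton.elim i 0], ?_, ?_⟩
    · simp only [Solution.toReal, hσ, List.map_map, List.mem_map, List.mem_range]
      exact ⟨c, hc, rfl⟩
    · rw [← hs.release]
      exact Nat.cast_le.2 h₁
    · simp only [Solution.toReal, hσ]
      exact_mod_cast h₂
  · refine add_le_add ?_ ?_
    · refine Real.iSup_le (fun j => ?_) (Nat.cast_nonneg _)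
      have := h.flow (π j) (π j).2
      simp only [Instance.flowTime, Solution.toReal, hσ, ← hs.processing, ← hs.release]
      rw [sub_le_iff_le_add]
      exact_mod_cast this
    · have : (cnt : ℝ) ≤ m := by exact_mod_cast h.cnt_le
      simp only [Instance.replCost, Solution.toReal, hσ, List.map_map, Function.comp_def,
        Finset.sum_singleton, List.map_const', List.sum_replicate, List.length_range, nsmul_eq_mul]
      push_cast
      gcongr

theorem program_correct (I : Instance 1) :
    I.IsAnswer (program.eval I.n
      (Store.ofInput (I.K₀ :: I.K 0 :: (List.ofFn I.encodeJob).flatten))).output := by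
  set σ₀ : State := Store.ofInput (I.K₀ :: I.K 0 :: (List.ofFn I.encodeJob).flatten) with hσ₀
  obtain ⟨hK, hread⟩ := readInput_spec I
  rw [← hσ₀] at hK hread
  set σ₁ := readInput.eval I.n σ₀ with hσ₁
  obtain ⟨⟨π, hπ⟩, hmono, hlast⟩ := sort_spec (n := I.n) (σ := σ₁) fun j hj => (hread ⟨j, hj⟩).2.2
  set σ₂ := sort.eval I.n σ₁ with hσ₂
  have f₁ := readInput.frame I.n σ₀
  have f₂ := sort.frame I.n σ₁
  have f₃ := search.frame I.n σ₂
  rw [← hσ₁] at f₁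
  rw [← hσ₂] at f₂
  have hbest : σ₂.var .best = 0 := (f₂.var .best rfl).trans (f₁.var .best rfl)
  have hD : σ₂.arr .D = fun _ => 0 := (f₂.arr .D rfl).trans (f₁.arr .D rfl)
  have hsorted : I.Sorted π (σ₂.arr .SR) (σ₂.arr .SP) :=
    ⟨fun j => (hπ j).2.1.trans (hread j).1, fun j => (hπ j).2.2.trans (hread j).2.1, hmono, hlast⟩
  obtain ⟨hrec, hbeats⟩ := search_spec (n := I.n) (σ := σ₂) hmono
    ⟨fun a _ => by rw [hD], .inl hbest⟩
  -- Without jobs no loop of the search runs, and `cnt` keeps its initial value.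
  have hcnt₀ : I.n = 0 → (search.eval I.n σ₂).var .cnt = 0 := fun h => by
    have : search.eval I.n σ₂ = σ₂ := by rw [h]; rfl
    rw [this]
    exact (f₂.var .cnt rfl).trans (f₁.var .cnt rfl)
  set σ₃ := search.eval I.n σ₂ with hσ₃
  have hK₃ : σ₃.var .K = I.K₀ + I.K 0 := (f₃.var .K rfl).trans ((f₂.var .K rfl).trans hK)
  have hSR : σ₃.arr .SR = σ₂.arr .SR := f₃.arr .SR rfl
  have hSP : σ₃.arr .SP = σ₂.arr .SP := f₃.arr .SP rfl
  have hRK : σ₃.arr .RK = σ₂.arr .RK := f₃.arr .RK rfl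
  have hout : σ₃.output = [] :=
    (f₃.output rfl).trans ((f₂.output rfl).trans (f₁.output rfl))
  obtain ⟨F, m, hm, hsched, hopt⟩ : ∃ F m, m ≤ I.n ∧
      IsSchedule (σ₂.arr .SR) (σ₂.arr .SP) I.n F m (σ₃.arr .S) (σ₃.arr .Q) (σ₃.var .cnt) ∧
      ∀ σ : Solution I.n 1 ℝ, I.Feasible σ →
        (F : ℝ) + m * (I.K₀ + I.K 0 : ℕ) ≤ I.cost σ := by
    rcases Nat.eq_zero_or_pos I.n with hn | hn
    · have : IsEmpty (Fin I.n) := by rw [hn]; infer_instance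
      refine ⟨0, 0, Nat.zero_le _, ⟨by rw [hcnt₀ hn], ?_, ?_, ?_, ?_⟩, fun σ _ => ?_⟩
      · intro l hl; omega
      · intro l l' _ hl; omega
      · intro l hl; omega
      · intro c c' _ hc; have := hcnt₀ hn; omega
      · have h₁ : I.Fmax σ = 0 := Real.iSup_of_isEmpty _
        have h₂ := length_filter_mul_le I σ.repl
        have h₃ : (0 : ℝ) ≤ I.replCost σ := le_trans (by positivity) h₂
        simpa [Instance.cost, h₁] using h₃
    · have key : ∀ F m, Good (σ₂.arr .SR) (σ₂.arr .SP) I.n F m 0 0 →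
          0 < σ₃.var .best ∧ σ₃.var .best ≤ F + m * (I.K₀ + I.K 0) + 1 := by
        intro F m hg
        obtain ⟨F', hF', hcand, hg'⟩ := hg.exists_candidate hn
        have hm : 1 ≤ m := by
          rcases m with _ | m
          · exact absurd (show 0 = I.n from hg) hn.ne
          · omega
        have := hbeats F' hcand m hm (by rwa [hSR, hSP])
        rw [hK₃] at this
        omega
      -- A single batch with all jobs is always possible for large `F`, so something has been
      -- recorded.
      have hex : Good (σ₂.arr .SR) (σ₂.arr .SP) I.n (σ₂.arr .SR (I.n - 1) +
          ∑ y ∈ Finset.Ico 0 I.n, σ₂.arr .SP y) 1 0 0 := by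
        refine ⟨I.n, hn, le_rfl, hlast _ (by omega), fun l _ hl => ?_, rfl⟩
        rw [max_eq_right (Nat.zero_le _)]
        have : ∑ x ∈ Finset.Ico 0 (l + 1), σ₂.arr .SP x ≤ ∑ x ∈ Finset.Ico 0 I.n, σ₂.arr .SP x :=
          Finset.sum_le_sum_of_subset (Finset.Ico_subset_Ico_right hl)
        omega
      rcases hrec with h | ⟨F, m, hm, hbest, hsched⟩
      · exact absurd (key _ _ hex).1 (by omega)
      · rw [hSR, hSP] at hsched
        refine ⟨F, m, hm, hsched, fun σ hσ => ?_⟩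
        obtain ⟨F', m', hg, hle⟩ := hσ.exists_good hsorted hn
        refine le_trans ?_ hle
        have := (key F' m' hg).2
        rw [hbest, hK₃] at this
        exact_mod_cast (show F + m * (I.K₀ + I.K 0) ≤ F' + m' * (I.K₀ + I.K 0) by omega)
  have heval : program.eval I.n σ₀ = writeOutput.eval I.n σ₃ := rfl
  rw [heval, writeOutput_spec (hsched.cnt_le.trans hm) hout]
  exact hsched.isAnswer hsorted hopt fun j => by rw [hRK]; exact (hπ j).1

end JRP

theorem theorem5 :
    RAM.SolvableInPolyTime (fun I : JRP.Instance 1 => I.encode) (fun I out => I.IsAnswer out) := by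
  obtain ⟨g, hg⟩ := JRP.Arr.exists_injective
  refine RAM.SolvableInPolyTime.of_cmd JRP.Var.ctorIdx_injective hg JRP.program fun I =>
    ⟨I.n, I.K₀ :: I.K 0 :: (List.ofFn I.encodeJob).flatten, ?_, ?_, JRP.program_correct I⟩
  · simp only [JRP.Instance.encode, List.ofFn_succ, List.ofFn_zero, List.cons_append,
      List.nil_append]
    rfl
  -- Each job takes three entries, its resource set being the single bit `1`, so the input has at
  -- least `n` entries.
  · have h : (List.ofFn fun j => (I.encodeJob j).length) = List.replicate I.n 3 := by
      refine List.ext_getElem (by simp) fun i _ _ => ?_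
      simp [JRP.Instance.encodeJob, JRP.bits_of_nonempty (I.req_nonempty _)]
    simp only [List.length_cons, List.length_flatten, List.map_ofFn, Function.comp_def, h,
      List.sum_replicate, smul_eq_mul]
    omega
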